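/- Call a partial function $F:\subseteq\mathbb{N}^{\mathbb{N}}\to\mathbb{N}^{\mathbb{N}}$ computable if it is computed by an oracle (Type-2) machine, that is, if there is one program that on input $n$ with oracle $p$ outputs the $n$-th term of $F(p)$, where $p\in\mathrm{dom}(F)$ if and only if the program halts for all $n$. A representation of a set $X$ is a surjective partial function $\sigma_X:\subseteq\mathbb{N}^{\mathbb{N}}\to X$; the $p$ with $\sigma_X(p)=x$ are the names of $x$. A realizer of a partial multi-valued function $f:\subseteq X\rightrightarrows Y$ between represented spaces is a partial function $G:\subseteq\mathbb{N}^{\mathbb{N}}\to\mathbb{N}^{\mathbb{N}}$ that maps every name of every $x\in\mathrm{dom}(f)$ to a name of some element of $f(x)$. We write $f\le_{\mathrm{sW}}g$ (strong Weihrauch reducibility) if there are computable $H,K:\subseteq\mathbb{N}^{\mathbb{N}}\to\mathbb{N}^{\mathbb{N}}$ such that $H\circ G\circ K$ is a realizer of $f$ for every realizer $G$ of $g$, and $f\equiv_{\mathrm{sW}}g$ if $f\le_{\mathrm{sW}}g$ and $g\le_{\mathrm{sW}}f$. For $n\ge1$ equip $\mathbb{R}^n$ with the Euclidean metric $d$ and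 fix an effective enumeration $(\alpha_k)_{k}$ of $\mathbb{Q}^n$. Points $x\in\mathbb{R}^n$ are represented by $p\in\mathbb{N}^{\mathbb{N}}$ with $d(\alpha_{p(i)},\alpha_{p(j)})\le2^{-i}$ for all $i\le j$ and $\lim_i\alpha_{p(i)}=x$. Closed sets $A\subseteq\mathbb{R}^n$ are represented by negative information: $p$ is a name of $A$ if $A=\mathbb{R}^n\setminus\bigcup_{i\in\mathbb{N}}B_{p(i)}$, where $(B_k)_k$ is the effective enumeration of all open balls with centre in $\mathbb{Q}^n$ and nonnegative rational radius (radius $0$ gives the empty ball). Pairs are represented by interleaving names. Closed choice $\mathrm{C}_{\mathbb{R}}$ maps a nonempty closed $A\subseteq\mathbb{R}$, given by negative information, to an arbitrary point of $A$. For $\varepsilon>0$, the $\varepsilon$-approximate negative closed projection operator $\varepsilon\text{-}\mathrm{Proj}^-_{\mathbb{R}^n}$ maps $(x,A)$, where $x\in\mathbb{R}^n$ and $A\subseteq\mathbb{R}^n$ is nonempty, closed and given by negative information, to an arbitrary $y\in A$ with $d(x,y)\le(1+\varepsilon)\,d(x,A)$. Theorem. For every real $\varepsilon>0$ and every integer $n\ge1$,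 $\varepsilon\text{-}\mathrm{Proj}^-_{\mathbb{R}^n}\equiv_{\mathrm{sW}}\mathrm{C}_{\mathbb{R}}$. -/

import Mathlib

open scoped Topology

namespace Weih

/-! ### Machines with an infinite input and an infinite output -/

/-- Points of Baire space `ℕ^ℕ`. -/
abbrev Baire : Type := ℕ → ℕ

/-- Programs of oracle machines: the programs for partial recursive functions together with one
instruction that queries the infinite input. -/
inductive OracleCode : Type
  | zero : OracleCode
  | succ : OracleCode
  | left : OracleCode
  | right : OracleCode
  | oracle : OracleCode
  | pair : OracleCode → OracleCode → OracleCode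
  | comp : OracleCode → OracleCode → OracleCode
  | prec : OracleCode → OracleCode → OracleCode
  | rfind : OracleCode → OracleCode

/-- `c.eval p` is the partial function `ℕ → ℕ` computed by the program `c` with the infinite
input `p`; the clauses are those of `Nat.RecursiveIn`. -/
def OracleCode.eval (p : Baire) : OracleCode → ℕ →. ℕ
  | .zero => fun _ => Part.some 0
  | .succ => fun n => Part.some (n + 1)
  | .left => fun n => Part.some n.unpair.1
  | .right => fun n => Part.some n.unpair.2
  | .oracle => fun n => Part.some (p n)
  | .pair c d => fun n => Nat.pair <$> c.eval p n <*> d.eval p n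
  | .comp c d => fun n => d.eval p n >>= c.eval p
  | .prec c d => fun m =>
      m.unpair.2.rec (c.eval p m.unpair.1) fun y IH => do
        let i ← IH
        d.eval p (Nat.pair m.unpair.1 (Nat.pair y i))
  | .rfind c => fun a => Nat.rfind fun n => (fun m => decide (m = 0)) <$> c.eval p (Nat.pair a n)

/-- For a fixed infinite input `p`, the programs compute exactly the functions that Mathlib calls
recursive in `p`. -/
theorem OracleCode.exists_eval_iff (p : Baire) (f : ℕ →. ℕ) :
    (∃ c : OracleCode, c.eval p = f) ↔ Nat.RecursiveIn {(p : ℕ →. ℕ)} f := by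
  constructor
  · rintro ⟨c, rfl⟩
    induction c with
    | zero => exact .zero
    | succ => exact .succ
    | left => exact .left
    | right => exact .right
    | oracle => exact .oracle _ rfl
    | pair _ _ h1 h2 => exact .pair h1 h2
    | comp _ _ h1 h2 => exact .comp h1 h2
    | prec _ _ h1 h2 => exact .prec h1 h2
    | rfind _ h => exact .rfind h
  · intro h
    induction h with
    | zero => exact ⟨.zero, rfl⟩
    | succ => exact ⟨.succ, rfl⟩
    | left => exact ⟨.left, rfl⟩
    | right => exact ⟨.right, rfl⟩
    | oracle g hg => obtain rfl := hg; exact ⟨.oracle, rfl⟩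
    | pair _ _ h1 h2 =>
      obtain ⟨c, rfl⟩ := h1; obtain ⟨d, rfl⟩ := h2; exact ⟨.pair c d, rfl⟩
    | comp _ _ h1 h2 =>
      obtain ⟨c, rfl⟩ := h1; obtain ⟨d, rfl⟩ := h2; exact ⟨.comp c d, rfl⟩
    | prec _ _ h1 h2 =>
      obtain ⟨c, rfl⟩ := h1; obtain ⟨d, rfl⟩ := h2; exact ⟨.prec c d, rfl⟩
    | rfind _ h => obtain ⟨c, rfl⟩ := h; exact ⟨.rfind c, rfl⟩

/-- The partial function on Baire space computed by a program: it is defined at `p` when every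
place of the output is produced, and the `n`-th output symbol is then `c.eval p n`. -/
def OracleCode.fn (c : OracleCode) : Baire →. Baire := fun p =>
  ⟨∀ n, (c.eval p n).Dom, fun h n => (c.eval p n).get (h n)⟩

/-- A partial function on Baire space is computable if some machine computes it. -/
def IsComputable (F : Baire →. Baire) : Prop := ∃ c : OracleCode, F = c.fn

/-! ### Representations, problems, strong Weihrauch reducibility -/

/-- A representation of `X`: a surjective partial function from Baire space onto `X`, given by its
graph (`Names p x` says that `p` is a name of `x`). -/
structure Representation (X : Type) where
  Names : Baire → X → Prop
  unique : ∀ {p x y}, Names p x → Names p y → x = y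
  surjective : ∀ x, ∃ p, Names p x

/-- The pairing `⟨p, q⟩` of two points of Baire space is `p 0, q 0, p 1, q 1, …`; a name of
`(x, y)` is the pairing of a name of `x` and a name of `y`. -/
def Representation.prod {X Y : Type} (σ : Representation X) (τ : Representation Y) :
    Representation (X × Y) where
  Names p z := σ.Names (fun n => p (2 * n)) z.1 ∧ τ.Names (fun n => p (2 * n + 1)) z.2
  unique h h' := Prod.ext (σ.unique h.1 h'.1) (τ.unique h.2 h'.2)
  surjective z := by
    obtain ⟨p, hp⟩ := σ.surjective z.1
    obtain ⟨q, hq⟩ := τ.surjective z.2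
    refine ⟨fun n => if n % 2 = 0 then p (n / 2) else q (n / 2), ?_, ?_⟩
    · convert hp using 2 with n
      simp
    · convert hq using 2 with n
      have h1 : (2 * n + 1) % 2 = 1 := by omega
      have h2 : (2 * n + 1) / 2 = n := by omega
      simp [h1, h2]

/-- A partial multi-valued function between represented spaces; its domain is the set of all `x`
with `values x` nonempty. -/
structure Problem where
  Input : Type
  Output : Type
  inRep : Representation Input
  outRep : Representation Output
  values : Input → Set Output

/-- `F` is a realizer of `f`: it maps every name of every point `x` of the domain of `f` to a name
of some element of `f x`. -/
def Realizes (F : Baire →. Baire) (f : Problem) : Prop :=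
  ∀ p x, f.inRep.Names p x → (f.values x).Nonempty →
    ∃ q ∈ F p, ∃ y ∈ f.values x, f.outRep.Names q y

/-- Strong Weihrauch reducibility: there are computable `H`, `K` such that `H ∘ G ∘ K` is a
realizer of `f` whenever `G` is a realizer of `g`. -/
def StrongReducible (f g : Problem) : Prop :=
  ∃ H K : Baire →. Baire, IsComputable H ∧ IsComputable K ∧
    ∀ G : Baire →. Baire, Realizes G g →
      Realizes (fun p => (K p).bind fun q => (G q).bind H) f

/-- Strong Weihrauch equivalence. -/
def StrongEquiv (f g : Problem) : Prop := StrongReducible f g ∧ StrongReducible g f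

/-! ### Computable metric spaces and their hyperspaces of closed sets -/

/-- An effective enumeration of the rational numbers (with repetitions). -/
def ratEnum (k : ℕ) : ℚ :=
  ((k.unpair.1.unpair.1 : ℚ) - (k.unpair.1.unpair.2 : ℚ)) / ((k.unpair.2 : ℚ) + 1)

/-- An effective enumeration of the nonnegative rational numbers (with repetitions). -/
def nnratEnum (m : ℕ) : ℚ := (m.unpair.1 : ℚ) / ((m.unpair.2 : ℚ) + 1)

/-- A computable metric space: a metric space with a dense sequence `pt` such that
`(i, j) ↦ dist (pt i) (pt j)` is a computable double sequence of real numbers. -/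
class ComputableMetricSpace (X : Type) [MetricSpace X] where
  pt : ℕ → X
  dense : DenseRange pt
  dist_computable : ∃ f : ℕ × ℕ × ℕ → ℕ, Computable f ∧
    ∀ i j k, |dist (pt i) (pt j) - (ratEnum (f (i, j, k)) : ℝ)| ≤ 2⁻¹ ^ k

section Spaces

variable (X : Type) [MetricSpace X] [ComputableMetricSpace X]

/-- The Cauchy representation. -/
def cauchyRep : Representation X where
  Names p x :=
    (∀ i j, i ≤ j → dist (ComputableMetricSpace.pt (X := X) (p i))
      (ComputableMetricSpace.pt (p j)) ≤ 2⁻¹ ^ i) ∧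
    Filter.Tendsto (fun i => ComputableMetricSpace.pt (X := X) (p i)) Filter.atTop (𝓝 x)
  unique h h' := tendsto_nhds_unique h.2 h'.2
  surjective x := by
    have h : ∀ i : ℕ, ∃ k, dist x (ComputableMetricSpace.pt (X := X) k) < 2⁻¹ ^ (i + 1) :=
      fun i => ComputableMetricSpace.dense.exists_dist_lt x (by positivity)
    choose p hp using h
    refine ⟨p, fun i j hij => ?_, ?_⟩
    · have h1 := dist_triangle_left (ComputableMetricSpace.pt (X := X) (p i))
        (ComputableMetricSpace.pt (p j)) x
      have h2 : (2⁻¹ : ℝ) ^ (j + 1) ≤ 2⁻¹ ^ (i + 1) :=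
        pow_le_pow_of_le_one (by norm_num) (by norm_num) (by omega)
      have h3 : (2⁻¹ : ℝ) ^ (i + 1) + 2⁻¹ ^ (i + 1) = 2⁻¹ ^ i := by ring
      linarith [hp i, hp j]
    · rw [tendsto_iff_dist_tendsto_zero]
      have h0 : Filter.Tendsto (fun i : ℕ => (2⁻¹ : ℝ) ^ (i + 1)) Filter.atTop (𝓝 0) :=
        (tendsto_pow_atTop_nhds_zero_of_lt_one (by norm_num) (by norm_num)).comp
          (Filter.tendsto_add_atTop_nat 1)
      refine squeeze_zero (fun _ => dist_nonneg) (fun i => ?_) h0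
      rw [dist_comm]
      exact (hp i).le

variable {X} in
/-- The basic open ball with index `k = ⟨n, m⟩`: centre `pt n` and radius `nnratEnum m`. It is
empty when the radius is zero. -/
def basicBall (k : ℕ) : Set X :=
  Metric.ball (ComputableMetricSpace.pt k.unpair.1) (nnratEnum k.unpair.2 : ℝ)

/-- The negative information representation of the closed subsets of `X`: a name of `A` lists
basic open balls whose union is the complement of `A`. -/
def negRep : Representation (TopologicalSpace.Closeds X) where
  Names p A := (A : Set X) = (⋃ i : ℕ, basicBall (p i))ᶜ
  unique h h' := SetLike.coe_injective (h.trans h'.symm)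
  surjective A := by
    classical
    refine ⟨fun k => if basicBall k ⊆ (A : Set X)ᶜ then k else 0, ?_⟩
    have h0 : (basicBall 0 : Set X) = ∅ := by
      simp [basicBall, nnratEnum]
    ext x
    simp only [Set.mem_compl_iff, Set.mem_iUnion, not_exists]
    constructor
    · intro hx k
      split_ifs with h
      · exact fun hk => h hk hx
      · simp [h0]
    · intro hx
      by_contra hA
      obtain ⟨r, hr, hball⟩ := Metric.isOpen_iff.1 A.isClosed.isOpen_compl x hA
      obtain ⟨b, hb⟩ := exists_nat_gt (2 / r)
      have hb1 : (0 : ℝ) < (b : ℝ) + 1 := by positivity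
      have hs : 2 * (1 / ((b : ℝ) + 1)) < r := by
        rw [div_lt_iff₀ hr] at hb
        rw [mul_one_div, div_lt_iff₀ hb1]
        nlinarith
      obtain ⟨n, hn⟩ := (ComputableMetricSpace.dense (X := X)).exists_dist_lt x
        (show (0 : ℝ) < 1 / ((b : ℝ) + 1) by positivity)
      have hset : (basicBall (Nat.pair n (Nat.pair 1 b)) : Set X) =
          Metric.ball (ComputableMetricSpace.pt n) (1 / ((b : ℝ) + 1)) := by
        simp [basicBall, nnratEnum]
      have hsub : (basicBall (Nat.pair n (Nat.pair 1 b)) : Set X) ⊆ (A : Set X)ᶜ := by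
        rw [hset]
        intro y hy
        apply hball
        rw [Metric.mem_ball] at hy ⊢
        have := dist_triangle_right y x (ComputableMetricSpace.pt (X := X) n)
        linarith
      have := hx (Nat.pair n (Nat.pair 1 b))
      rw [if_pos hsub, hset, Metric.mem_ball] at this
      exact this hn

/-! ### The two problems -/

/-- Closed choice on `X`: given a nonempty closed set by negative information, find a point of
it. -/
def closedChoice : Problem where
  Input := TopologicalSpace.Closeds X
  Output := X
  inRep := negRep X
  outRep := cauchyRep X
  values A := (A : Set X)

/-- The `ε`-approximate negative closed projection operator on `X`: given a point `x` and a
nonempty closed set `A`, the latter by negative information, find an `ε`-projection point of `x`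
onto `A`, that is `y ∈ A` with `d(x, y) ≤ (1 + ε) d(x, A)`. -/
noncomputable def approxNegProj (ε : ℝ) : Problem where
  Input := X × TopologicalSpace.Closeds X
  Output := X
  inRep := (cauchyRep X).prod (negRep X)
  outRep := cauchyRep X
  values z := {y | y ∈ z.2 ∧ dist z.1 y ≤ (1 + ε) * Metric.infDist z.1 (z.2 : Set X)}

end Spaces

/-! ### The Euclidean spaces as computable metric spaces -/

/-- The `k`-th rational point of `ℝ^n`: decode `k` as a finite list of natural numbers and apply
the enumeration of the rational numbers to its first `n` entries (absent entries count as `0`). -/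
noncomputable def ratPoint (n k : ℕ) : EuclideanSpace ℝ (Fin n) :=
  WithLp.toLp 2 fun i => (ratEnum ((Denumerable.ofNat (List ℕ) k).getD i 0) : ℝ)


theorem ratEnum_surjective : Function.Surjective ratEnum := by
  intro q
  refine ⟨Nat.pair (Nat.pair q.num.toNat (-q.num).toNat) (q.den - 1), ?_⟩
  have h1 : ((q.den - 1 : ℕ) : ℚ) + 1 = q.den := by
    have := q.den_pos
    exact_mod_cast Nat.sub_add_cancel this
  have h2 : ((q.num.toNat : ℚ) - ((-q.num).toNat : ℚ)) = q.num := by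
    exact_mod_cast (show ((q.num.toNat : ℤ) - ((-q.num).toNat : ℤ)) = q.num by omega)
  simp only [ratEnum, Nat.unpair_pair]
  rw [h1, h2, Rat.num_div_den]

/-- Numerator of the square of the difference of two enumerated rational numbers. -/
def sqNum (x y : ℕ) : ℕ :=
  let u := x.unpair.1.unpair.1 * (y.unpair.2 + 1) + y.unpair.1.unpair.2 * (x.unpair.2 + 1)
  let v := x.unpair.1.unpair.2 * (y.unpair.2 + 1) + y.unpair.1.unpair.1 * (x.unpair.2 + 1)
  ((u - v) + (v - u)) * ((u - v) + (v - u))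

/-- Denominator of the square of the difference of two enumerated rational numbers. -/
def sqDen (x y : ℕ) : ℕ :=
  ((x.unpair.2 + 1) * (y.unpair.2 + 1)) * ((x.unpair.2 + 1) * (y.unpair.2 + 1))

theorem sqDen_pos (x y : ℕ) : 0 < sqDen x y := by unfold sqDen; positivity

theorem sq_ratEnum_sub (x y : ℕ) :
    ((ratEnum x : ℝ) - (ratEnum y : ℝ)) ^ 2 = (sqNum x y : ℝ) / (sqDen x y : ℝ) := by
  have key : ∀ u v : ℕ, ((((u - v) + (v - u)) * ((u - v) + (v - u)) : ℕ) : ℝ)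
      = ((u : ℝ) - v) ^ 2 := by
    intro u v
    rcases le_total u v with h | h
    · rw [Nat.sub_eq_zero_of_le h]; push_cast [Nat.cast_sub h]; ring
    · rw [Nat.sub_eq_zero_of_le h]; push_cast [Nat.cast_sub h]; ring
  simp only [sqNum, key, sqDen, ratEnum]
  push_cast
  field_simp
  ring

theorem sqNum_primrec : Primrec₂ sqNum := by
  have hx : Primrec fun z : ℕ × ℕ => z.1.unpair := Primrec.unpair.comp Primrec.fst
  have hy : Primrec fun z : ℕ × ℕ => z.2.unpair := Primrec.unpair.comp Primrec.snd
  have hx1 : Primrec fun z : ℕ × ℕ => z.1.unpair.1.unpair :=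
    Primrec.unpair.comp (Primrec.fst.comp hx)
  have hy1 : Primrec fun z : ℕ × ℕ => z.2.unpair.1.unpair :=
    Primrec.unpair.comp (Primrec.fst.comp hy)
  have hxd : Primrec fun z : ℕ × ℕ => z.1.unpair.2 + 1 := Primrec.succ.comp (Primrec.snd.comp hx)
  have hyd : Primrec fun z : ℕ × ℕ => z.2.unpair.2 + 1 := Primrec.succ.comp (Primrec.snd.comp hy)
  have hu := Primrec.nat_add.comp (Primrec.nat_mul.comp (Primrec.fst.comp hx1) hyd)
    (Primrec.nat_mul.comp (Primrec.snd.comp hy1) hxd)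
  have hv := Primrec.nat_add.comp (Primrec.nat_mul.comp (Primrec.snd.comp hx1) hyd)
    (Primrec.nat_mul.comp (Primrec.fst.comp hy1) hxd)
  have hs := Primrec.nat_add.comp (Primrec.nat_sub.comp hu hv) (Primrec.nat_sub.comp hv hu)
  exact (Primrec.nat_mul.comp hs hs).of_eq fun z => rfl

theorem sqDen_primrec : Primrec₂ sqDen := by
  have hxd : Primrec fun z : ℕ × ℕ => z.1.unpair.2 + 1 :=
    Primrec.succ.comp (Primrec.snd.comp (Primrec.unpair.comp Primrec.fst))
  have hyd : Primrec fun z : ℕ × ℕ => z.2.unpair.2 + 1 :=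
    Primrec.succ.comp (Primrec.snd.comp (Primrec.unpair.comp Primrec.snd))
  have hm := Primrec.nat_mul.comp hxd hyd
  exact (Primrec.nat_mul.comp hm hm).of_eq fun z => rfl

/-- Index of a rational number within `2^(-k)` of the square root of `N / M`. -/
def sqrtIndex (N M k : ℕ) : ℕ :=
  Nat.pair (Nat.pair (Nat.sqrt (N * M * (2 ^ k * 2 ^ k))) 0) (2 ^ k * M - 1)

theorem sqrtIndex_spec (N M k : ℕ) (hM : 0 < M) :
    |Real.sqrt ((N : ℝ) / M) - (ratEnum (sqrtIndex N M k) : ℝ)| ≤ 2⁻¹ ^ k := by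
  have hM' : (0 : ℝ) < M := by exact_mod_cast hM
  have hP : 0 < 2 ^ k * M := by positivity
  have hden : ((2 ^ k * M - 1 : ℕ) : ℝ) + 1 = 2 ^ k * M := by
    exact_mod_cast Nat.sub_add_cancel hP
  set t := Nat.sqrt (N * M * (2 ^ k * 2 ^ k)) with ht
  have hr : (ratEnum (sqrtIndex N M k) : ℝ) = t / (2 ^ k * M) := by
    simp only [ratEnum, sqrtIndex, Nat.unpair_pair, ← ht]
    push_cast
    rw [hden]; simp
  have hpos : (0 : ℝ) < 2 ^ k * M := by positivity
  have hs : Real.sqrt ((N : ℝ) / M) = Real.sqrt (N * M * (2 ^ k * 2 ^ k)) / (2 ^ k * M) := by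
    rw [eq_div_iff hpos.ne']
    rw [← Real.sqrt_sq hpos.le, ← Real.sqrt_mul (by positivity)]
    congr 1
    field_simp
  have h1 : (t : ℝ) ≤ Real.sqrt (N * M * (2 ^ k * 2 ^ k)) := by
    apply Real.le_sqrt_of_sq_le
    exact_mod_cast Nat.sqrt_le' _
  have h2 : Real.sqrt (N * M * (2 ^ k * 2 ^ k)) ≤ t + 1 := by
    rw [Real.sqrt_le_left (by positivity)]
    exact_mod_cast (Nat.lt_succ_sqrt' _).le
  rw [hr, hs, ← sub_div, abs_of_nonneg (div_nonneg (by linarith) hpos.le), div_le_iff₀ hpos]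
  have h3 : (2⁻¹ : ℝ) ^ k * (2 ^ k * M) = M := by
    rw [← mul_assoc, ← mul_pow]; norm_num
  have h4 : (1 : ℝ) ≤ M := by exact_mod_cast hM
  rw [h3]; linarith

theorem sqrtIndex_computable {N M k : ℕ × ℕ × ℕ → ℕ} (hN : Computable N) (hM : Computable M)
    (hk : Computable k) : Computable fun z => sqrtIndex (N z) (M z) (k z) := by
  have hpow : Primrec fun n : ℕ => 2 ^ n :=
    (Primrec.nat_rec₁ (f := fun _ r => 2 * r) 1
      (Primrec.nat_mul.comp (Primrec.const 2) Primrec.snd)).of_eq fun n => by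
        induction n with
        | zero => rfl
        | succ n ih => rw [pow_succ, ← ih, mul_comm]
  have hp : Computable fun z => 2 ^ k z := hpow.to_comp.comp hk
  have mul := Primrec.nat_mul.to_comp
  have h1 := mul.comp (mul.comp hN hM) (mul.comp hp hp)
  have h2 := Primrec.nat_sqrt.to_comp.comp h1
  have h3 := Primrec.nat_sub.to_comp.comp (mul.comp hp hM) (Computable.const 1)
  exact (Primrec₂.natPair.to_comp.comp (Primrec₂.natPair.to_comp.comp h2 (Computable.const 0))
    h3).of_eq fun z => rfl

/-- The real line with the enumeration of the rational numbers. -/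
noncomputable instance instRealComputableMetricSpace : ComputableMetricSpace ℝ where
  pt k := (ratEnum k : ℝ)
  dense := Rat.isDenseEmbedding_coe_real.dense.comp ratEnum_surjective.denseRange
    Rat.continuous_coe_real
  dist_computable := by
    refine ⟨fun z => sqrtIndex (sqNum z.1 z.2.1) (sqDen z.1 z.2.1) z.2.2, ?_, fun i j k => ?_⟩
    · have h1 : Computable fun z : ℕ × ℕ × ℕ => z.1 := Computable.fst
      have h2 : Computable fun z : ℕ × ℕ × ℕ => z.2.1 := Computable.fst.comp Computable.snd
      exact sqrtIndex_computable (sqNum_primrec.to_comp.comp h1 h2)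
        (sqDen_primrec.to_comp.comp h1 h2) (Computable.snd.comp Computable.snd)
    · have := sqrtIndex_spec (sqNum i j) (sqDen i j) k (sqDen_pos i j)
      rwa [← sq_ratEnum_sub, Real.sqrt_sq_eq_abs, ← Real.dist_eq] at this

/-- Numerator and denominator of the squared distance of two rational points of `ℝ^n`. -/
def sqDist (i j : ℕ) : ℕ → ℕ × ℕ
  | 0 => (0, 1)
  | n + 1 =>
    let x := (Denumerable.ofNat (List ℕ) i).getD n 0
    let y := (Denumerable.ofNat (List ℕ) j).getD n 0
    ((sqDist i j n).1 * sqDen x y + sqNum x y * (sqDist i j n).2, (sqDist i j n).2 * sqDen x y)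

theorem sqDist_pos (i j n : ℕ) : 0 < (sqDist i j n).2 := by
  induction n with
  | zero => exact Nat.one_pos
  | succ n ih => exact Nat.mul_pos ih (sqDen_pos _ _)

theorem sqDist_spec (i j n : ℕ) :
    dist (ratPoint n i) (ratPoint n j) =
      Real.sqrt (((sqDist i j n).1 : ℝ) / ((sqDist i j n).2 : ℝ)) := by
  rw [EuclideanSpace.dist_eq]
  congr 1
  induction n with
  | zero => simp [sqDist]
  | succ n ih =>
    rw [Fin.sum_univ_castSucc]
    have h1 := sqDist_pos i j n
    simp only [ratPoint, Fin.val_castSucc, Fin.val_last, Real.dist_eq, sq_abs] at ih ⊢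
    rw [ih, sq_ratEnum_sub]
    simp only [sqDist]
    have h2 := sqDen_pos ((Denumerable.ofNat (List ℕ) i).getD n 0)
      ((Denumerable.ofNat (List ℕ) j).getD n 0)
    push_cast
    rw [div_add_div _ _ (by positivity) (by positivity)]
    ring

theorem sqDist_primrec (n : ℕ) : Primrec₂ fun i j => sqDist i j n := by
  induction n with
  | zero => exact Primrec.const (0, 1)
  | succ n ih =>
    have hx : Primrec fun z : ℕ × ℕ => (Denumerable.ofNat (List ℕ) z.1).getD n 0 :=
      (Primrec.list_getD 0).comp ((Primrec.ofNat (List ℕ)).comp Primrec.fst) (Primrec.const n)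
    have hy : Primrec fun z : ℕ × ℕ => (Denumerable.ofNat (List ℕ) z.2).getD n 0 :=
      (Primrec.list_getD 0).comp ((Primrec.ofNat (List ℕ)).comp Primrec.snd) (Primrec.const n)
    have hd := sqDen_primrec.comp hx hy
    have hn := sqNum_primrec.comp hx hy
    have ih' : Primrec fun z : ℕ × ℕ => sqDist z.1 z.2 n := ih
    have h1 := Primrec.fst.comp ih'
    have h2 := Primrec.snd.comp ih'
    exact (Primrec.pair (Primrec.nat_add.comp (Primrec.nat_mul.comp h1 hd)
      (Primrec.nat_mul.comp hn h2)) (Primrec.nat_mul.comp h2 hd)).of_eq fun z => rfl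

theorem ratPoint_dense (n : ℕ) : DenseRange (ratPoint n) := by
  have h : DenseRange fun q : Fin n → ℚ =>
      (WithLp.toLp 2 fun i => (q i : ℝ) : EuclideanSpace ℝ (Fin n)) := by
    have h1 : DenseRange fun (q : Fin n → ℚ) (i : Fin n) => (q i : ℝ) :=
      DenseRange.piMap fun _ => Rat.isDenseEmbedding_coe_real.dense
    exact (EuclideanSpace.equiv (Fin n) ℝ).symm.surjective.denseRange.comp h1
      (EuclideanSpace.equiv (Fin n) ℝ).symm.continuous
  refine h.mono ?_
  rintro _ ⟨q, rfl⟩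
  choose g hg using ratEnum_surjective
  refine ⟨Encodable.encode (List.ofFn fun i => g (q i)), ?_⟩
  simp only [ratPoint, Denumerable.ofNat_encode]
  congr 1
  funext i
  simp [List.getD, hg]

/-- Euclidean space `ℝ^n` with the enumeration of its rational points. -/
noncomputable instance instEuclideanComputableMetricSpace (n : ℕ) :
    ComputableMetricSpace (EuclideanSpace ℝ (Fin n)) where
  pt := ratPoint n
  dense := ratPoint_dense n
  dist_computable := by
    refine ⟨fun z => sqrtIndex (sqDist z.1 z.2.1 n).1 (sqDist z.1 z.2.1 n).2 z.2.2, ?_,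
      fun i j k => ?_⟩
    · have h : Computable fun z : ℕ × ℕ × ℕ => sqDist z.1 z.2.1 n :=
        (sqDist_primrec n).to_comp.comp Computable.fst (Computable.fst.comp Computable.snd)
      exact sqrtIndex_computable (Computable.fst.comp h) (Computable.snd.comp h)
        (Computable.snd.comp Computable.snd)
    · rw [sqDist_spec]
      exact sqrtIndex_spec _ _ k (sqDist_pos i j n)

end Weih

/-! Upper bound. Fix a rational `u` with `1 < u ≤ 1 + ε`. If `q ≤ d(x, A)`, then every point of `A`
within distance `u * q` of `x` is a solution. Such points exist for a suitable rational `q`: `q = 0`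
if `x ∈ A`, and otherwise any `q` strictly between `d(x, A) / u` and `d(x, A)`. The reduction does
not compute `q`; closed choice guesses it. By compactness `q < d(x, A)` is eventually visible in the
name: at some stage `t` every small cell of a large enough cube `[-S, S]^n` is seen to be either
inside a removed ball or too far from `x` (`exists_farCert`). Conversely such a certificate, which
is decidable once `t` is given, implies `q ≤ d(x, A)` (`FarCert.le_infDist`).

The guess and the solution are packed into one real number `z`. Its integral part codes `(S, q, t)`,
and its digits in base `2 ^ (n + 1)` choose successive dyadic subcells of the cube. Numbers with a
false certificate, or whose digits reach a cell that visibly misses `A` or visibly lies farther than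
`u * q` from `x`, are removed from the line. What remains is closed, with a computable negative name
(`digitSet_eq`), and nonempty (`digitSet_treeBad_nonempty`); each of its points yields a solution
(`exists_approxProj_of_mem_digitSet`).

Reading digits of a real number is in general discontinuous. Only half of the digits are needed, so
all `z` for which some `B ^ k * z` has fractional part above one half are removed as well; on the
rest the digits can be read from a finite approximation (`floorIndex_eq`). The decoding uses `z`
alone, because the outer function of a strong reduction does not see the original input; this is why
`S` is part of the code.

Lower bound. Send `A ⊆ ℝ` to the origin together with the set of points of `ℝ^n` whose first
coordinate is in `A`. Any approximate projection point lies in this set, and its first coordinate is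
a point of `A`. -/

namespace Weih

open Encodable Denumerable

/-! ### Machines reading a finite part of the input -/

theorem OracleCode.eval_comp_of_eq {c d : OracleCode} {p : Baire} {n m : ℕ}
    (h : d.eval p n = Part.some m) : (comp c d).eval p n = c.eval p m := by
  simp only [eval, h]
  exact Part.bind_some _ _

theorem OracleCode.eval_pair_of_eq {c d : OracleCode} {p : Baire} {n a b : ℕ}
    (hc : c.eval p n = Part.some a) (hd : d.eval p n = Part.some b) :
    (pair c d).eval p n = Part.some (Nat.pair a b) := by
  simp [eval, hc, hd, Seq.seq]

theorem OracleCode.eval_prec_of_eq {c d : OracleCode} {p : Baire} {a : ℕ} {f : ℕ → ℕ}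
    (h0 : c.eval p a = Part.some (f 0))
    (hs : ∀ k, d.eval p (Nat.pair a (Nat.pair k (f k))) = Part.some (f (k + 1))) (k : ℕ) :
    (prec c d).eval p (Nat.pair a k) = Part.some (f k) := by
  simp only [eval, Nat.unpair_pair]
  induction k with
  | zero => exact h0
  | succ k ih =>
    rw [← hs k]
    dsimp only
    rw [ih]
    exact Part.bind_some _ _

theorem OracleCode.exists_eval_eq_of_primrec {f : ℕ → ℕ} (hf : Nat.Primrec f) :
    ∃ c : OracleCode, ∀ p n, c.eval p n = Part.some (f n) := by
  induction hf with
  | zero => exact ⟨.zero, fun _ _ => rfl⟩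
  | succ => exact ⟨.succ, fun _ _ => rfl⟩
  | left => exact ⟨.left, fun _ _ => rfl⟩
  | right => exact ⟨.right, fun _ _ => rfl⟩
  | pair _ _ h1 h2 =>
    obtain ⟨c, hc⟩ := h1; obtain ⟨d, hd⟩ := h2
    exact ⟨.pair c d, fun p n => eval_pair_of_eq (hc p n) (hd p n)⟩
  | comp _ _ h1 h2 =>
    obtain ⟨c, hc⟩ := h1; obtain ⟨d, hd⟩ := h2
    exact ⟨.comp c d, fun p n => (eval_comp_of_eq (hd p n)).trans (hc p _)⟩
  | prec _ _ h1 h2 =>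
    obtain ⟨c, hc⟩ := h1; obtain ⟨d, hd⟩ := h2
    refine ⟨.prec c d, fun p n => ?_⟩
    rw [← Nat.pair_unpair n, eval_prec_of_eq (f := fun k => Nat.unpaired _ (Nat.pair n.unpair.1 k))]
    · simp [hc]
    · intro k
      simp [hd]

/-- The list of the first `n` terms of a point of Baire space. -/
def initSeg (p : Baire) (n : ℕ) : List ℕ := (List.range n).map p

theorem getD_initSeg {p : Baire} {n i : ℕ} (h : i < n) : (initSeg p n).getD i 0 = p i := by
  simp [initSeg, h]

theorem OracleCode.exists_eval_eq_initSeg :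
    ∃ c : OracleCode, ∀ p n, c.eval p n = Part.some (encode (initSeg p n)) := by
  have h1 : Primrec fun z : ℕ => encode (ofNat (List ℕ) z.unpair.1 ++ [z.unpair.2]) :=
    Primrec.encode.comp (Primrec.list_concat.comp
      ((Primrec.ofNat (List ℕ)).comp (Primrec.fst.comp Primrec.unpair))
      (Primrec.snd.comp Primrec.unpair))
  obtain ⟨a, ha⟩ := exists_eval_eq_of_primrec (Primrec.nat_iff.1 h1)
  obtain ⟨b, hb⟩ := exists_eval_eq_of_primrec (Primrec.nat_iff.1 (.const (encode ([] : List ℕ))))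
  obtain ⟨u, hu⟩ := exists_eval_eq_of_primrec
    (Primrec.nat_iff.1 (Primrec₂.natPair.comp (.const 0) .id))
  -- The recursion step: on `⟨0, ⟨n, l⟩⟩`, with `0` a dummy parameter, query the oracle at `n` and
  -- append the answer to the list coded by `l`.
  set d : OracleCode := .comp a (.pair (.comp .right .right)
    (.comp .oracle (.comp .left .right))) with hd
  have hstep : ∀ p n l, d.eval p (Nat.pair 0 (Nat.pair n (encode l))) =
      Part.some (encode (l ++ [p n])) := fun p n l => by
    have h2 : (OracleCode.comp .right .right).eval p (Nat.pair 0 (Nat.pair n (encode l))) =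
        Part.some (encode l) := by
      rw [eval_comp_of_eq (m := Nat.pair n (encode l)) (by simp only [eval, Nat.unpair_pair])]
      simp only [eval, Nat.unpair_pair]
    have h3 : (OracleCode.comp .oracle (.comp .left .right)).eval p
        (Nat.pair 0 (Nat.pair n (encode l))) = Part.some (p n) := by
      rw [eval_comp_of_eq (m := n)]
      · simp only [eval]
      · rw [eval_comp_of_eq (m := Nat.pair n (encode l)) (by simp only [eval, Nat.unpair_pair])]
        simp only [eval, Nat.unpair_pair]
    rw [hd, eval_comp_of_eq (eval_pair_of_eq h2 h3), ha]
    simp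
  refine ⟨.comp (.prec b d) u, fun p n => ?_⟩
  rw [eval_comp_of_eq (hu p n)]
  refine eval_prec_of_eq (f := fun k => encode (initSeg p k)) (hb p 0) (fun k => ?_) n
  rw [hstep]
  simp [initSeg, List.range_succ]

/-- A function on Baire space is computable if the `e`-th term of the output is a primitive
recursive function of a finite part of the input, whose length is a primitive recursive function
of `e` and one fixed term of the input. -/
theorem isComputable_of_primrec {F : Baire → Baire} {g : ℕ → List ℕ → ℕ} {h : ℕ → ℕ → ℕ}
    (hg : Primrec₂ g) (hh : Primrec₂ h) (m : ℕ)
    (hF : ∀ p e, F p e = g e (initSeg p (h e (p m)))) : IsComputable fun p => Part.some (F p) := by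
  obtain rfl : F = fun p e => g e (initSeg p (h e (p m))) := funext₂ hF
  obtain ⟨a, ha⟩ := OracleCode.exists_eval_eq_of_primrec
    (Primrec.nat_iff.1 (Primrec₂.unpaired.2 hh))
  obtain ⟨b, hb⟩ := OracleCode.exists_eval_eq_initSeg
  have h1 : Primrec fun z : ℕ => g z.unpair.1 (ofNat (List ℕ) z.unpair.2) :=
    hg.comp (Primrec.fst.comp Primrec.unpair)
      ((Primrec.ofNat (List ℕ)).comp (Primrec.snd.comp Primrec.unpair))
  obtain ⟨u, hu⟩ := OracleCode.exists_eval_eq_of_primrec (Primrec.nat_iff.1 h1)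
  obtain ⟨v, hv⟩ := OracleCode.exists_eval_eq_of_primrec (Primrec.nat_iff.1 .id)
  obtain ⟨w, hw⟩ := OracleCode.exists_eval_eq_of_primrec (Primrec.nat_iff.1 (.const m))
  let d : OracleCode := .comp a (.pair v (.comp .oracle w))
  have hd : ∀ p n, d.eval p n = Part.some (h n (p m)) := fun p n => by
    have h2 : (OracleCode.comp .oracle w).eval p n = Part.some (p m) :=
      (OracleCode.eval_comp_of_eq (hw p n)).trans rfl
    rw [OracleCode.eval_comp_of_eq (OracleCode.eval_pair_of_eq (hv p n) h2), ha]
    simp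
  have key : ∀ p n, (OracleCode.comp u (.pair v (.comp b d))).eval p n =
      Part.some (g n (initSeg p (h n (p m)))) := fun p n => by
    rw [OracleCode.eval_comp_of_eq (OracleCode.eval_pair_of_eq (hv p n)
      ((OracleCode.eval_comp_of_eq (hd p n)).trans (hb p _))), hu]
    simp
  refine ⟨.comp u (.pair v (.comp b d)), funext fun p => ?_⟩
  refine Part.ext' ?_ fun _ _ => ?_
  · simp [OracleCode.fn, key]
  · funext n
    simp [OracleCode.fn, key]

/-- To reduce `f` to `g` it suffices to give total computable functions which carry every name of
an instance of `f` to a name of an instance of `g`, and the names of its solutions to names of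
solutions of the original instance. -/
theorem strongReducible_of_total {f g : Problem} {H K : Baire → Baire}
    (hH : IsComputable fun p => Part.some (H p)) (hK : IsComputable fun p => Part.some (K p))
    (h : ∀ p x, f.inRep.Names p x → (f.values x).Nonempty →
      ∃ a, g.inRep.Names (K p) a ∧ (g.values a).Nonempty ∧
        ∀ b ∈ g.values a, ∀ q, g.outRep.Names q b → ∃ y ∈ f.values x, f.outRep.Names (H q) y) :
    StrongReducible f g := by
  refine ⟨_, _, hH, hK, fun G hG p x hp hx => ?_⟩
  obtain ⟨a, ha, hne, hb⟩ := h p x hp hx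
  obtain ⟨q, hq, b, hba, hqb⟩ := hG _ a ha hne
  obtain ⟨y, hy, hyn⟩ := hb b hba q hqb
  refine ⟨H q, ?_, y, hy, hyn⟩
  simp only [Part.bind_some, Part.mem_bind_iff, Part.mem_some_iff]
  exact ⟨q, hq, rfl⟩

theorem dist_pt_le_of_names {X : Type} [MetricSpace X] [ComputableMetricSpace X] {p : Baire}
    {x : X} (h : (cauchyRep X).Names p x) (i : ℕ) :
    dist (ComputableMetricSpace.pt (X := X) (p i)) x ≤ 2⁻¹ ^ i := by
  refine le_of_tendsto (tendsto_const_nhds.dist h.2) ?_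
  filter_upwards [Filter.eventually_ge_atTop i] with j hj using h.1 i j hj

/-! ### Trees of digit expansions as closed sets of real numbers -/

/-- The numbers `x ≥ 0` such that, for every `k`, the fractional part of `B ^ k * x` is at most
one half and the integral part of `B ^ k * x` does not have the property `P k`. -/
def digitSet (B : ℕ) (P : ℕ → ℕ → Prop) : Set ℝ :=
  {x | 0 ≤ x ∧ ∀ k, Int.fract ((B : ℝ) ^ k * x) ≤ 1 / 2 ∧ ¬ P k ⌊(B : ℝ) ^ k * x⌋₊}

/-- The index of the ball in `ℝ` with centre `(a - b) / (c + 1)` and radius `r / (c + 1)`. -/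
def intervalIndex (a b r c : ℕ) : ℕ := Nat.pair (Nat.pair (Nat.pair a b) c) (Nat.pair r c)

open Classical in
/-- The balls which are removed from `ℝ` to obtain `digitSet B P`: those over the second halves of
the intervals `[N / B ^ k, (N + 1) / B ^ k]`, those over the first halves of such intervals for
which `P k N` holds, and those of negative numbers. -/
noncomputable def digitBall (B : ℕ) (P : ℕ → ℕ → Prop) (a k N : ℕ) : ℕ :=
  if a = 0 then intervalIndex (4 * N + 3) 0 1 (4 * B ^ k - 1)
  else if a = 1 then if P k N then intervalIndex (4 * N + 1) 0 2 (4 * B ^ k - 1) else 0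
  else intervalIndex 0 (N + 1) (N + 1) 0

/-- A sequence of indices of balls which cover the complement of `digitSet B P`. -/
noncomputable def digitSetName (B : ℕ) (P : ℕ → ℕ → Prop) (e : ℕ) : ℕ :=
  digitBall B P e.unpair.1 e.unpair.2.unpair.1 e.unpair.2.unpair.2

theorem mem_basicBall_intervalIndex {a b r c : ℕ} {x : ℝ} :
    x ∈ (basicBall (intervalIndex a b r c) : Set ℝ) ↔
      |((c : ℝ) + 1) * x - (a - b)| < r := by
  have hc : (0 : ℝ) < (c : ℝ) + 1 := by positivity
  have h : ((c : ℝ) + 1) * x - (a - b) = (x - (a - b) / (c + 1)) * (c + 1) := by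
    field_simp
  simp only [basicBall, intervalIndex, Nat.unpair_pair, Metric.mem_ball, Real.dist_eq, nnratEnum,
    ComputableMetricSpace.pt, ratEnum]
  push_cast
  rw [h, abs_mul, abs_of_pos hc, lt_div_iff₀ hc]

theorem not_mem_basicBall_zero (x : ℝ) : x ∉ (basicBall 0 : Set ℝ) := by
  simp [basicBall, nnratEnum]

/-- The half-integral gaps leave room for open sets. Above `[N, N + 1] / B ^ k` the first kind of
ball is `(N + 1/2, N + 1) / B ^ k`. The second kind is `(N - 1/4, N + 3/4) / B ^ k`, which covers
the closed first half and otherwise meets only numbers that the gaps exclude. -/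
theorem digitSet_eq {B : ℕ} (hB : 0 < B) (P : ℕ → ℕ → Prop) :
    digitSet B P = (⋃ e, basicBall (digitSetName B P e))ᶜ := by
  -- An index stores the denominator minus one.
  have hden : ∀ k : ℕ, ((4 * B ^ k - 1 : ℕ) : ℝ) + 1 = 4 * (B : ℝ) ^ k := fun k => by
    exact_mod_cast Nat.sub_add_cancel (show 1 ≤ 4 * B ^ k by have := pow_pos hB k; omega)
  have h0 : ∀ k N : ℕ, ∀ x : ℝ, x ∈ (basicBall (digitBall B P 0 k N) : Set ℝ) ↔
      |4 * (B : ℝ) ^ k * x - (4 * N + 3)| < 1 := fun k N x => by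
    rw [digitBall, if_pos rfl, mem_basicBall_intervalIndex, hden]
    push_cast
    rw [sub_zero]
  have h1 : ∀ k N : ℕ, P k N → ∀ x : ℝ, (x ∈ (basicBall (digitBall B P 1 k N) : Set ℝ) ↔
      |4 * (B : ℝ) ^ k * x - (4 * N + 1)| < 2) := fun k N hP x => by
    rw [digitBall, if_neg one_ne_zero, if_pos rfl, if_pos hP, mem_basicBall_intervalIndex, hden]
    push_cast
    rw [sub_zero]
  have h2 : ∀ a k N : ℕ, ∀ x : ℝ, x ∈ (basicBall (digitBall B P (a + 2) k N) : Set ℝ) ↔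
      |x + (N + 1)| < N + 1 := fun a k N x => by
    rw [digitBall, if_neg (by omega), if_neg (by omega), mem_basicBall_intervalIndex]
    push_cast
    rw [show (0 + 1 : ℝ) * x - (0 - (N + 1)) = x + (N + 1) by ring]
  have hmem : ∀ x, (∀ e, x ∉ (basicBall (digitSetName B P e) : Set ℝ)) ↔
      ∀ a k N, x ∉ (basicBall (digitBall B P a k N) : Set ℝ) := fun x =>
    ⟨fun h a k N => by simpa [digitSetName] using h (Nat.pair a (Nat.pair k N)), fun h e => h _ _ _⟩
  ext x
  simp only [Set.mem_compl_iff, Set.mem_iUnion, not_exists, hmem]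
  constructor
  · rintro ⟨hx0, hx⟩ a k N
    have key : ∀ k, ∃ t : ℝ, 0 ≤ t ∧ t ≤ 1 / 2 ∧
        (B : ℝ) ^ k * x = ⌊(B : ℝ) ^ k * x⌋₊ + t := fun k =>
      ⟨Int.fract ((B : ℝ) ^ k * x), Int.fract_nonneg _, (hx k).1, by
        rw [natCast_floor_eq_intCast_floor (by positivity), Int.floor_add_fract]⟩
    obtain ⟨t, ht0, ht1, ht⟩ := key k
    have hx2 := (hx k).2
    set M := ⌊(B : ℝ) ^ k * x⌋₊
    rcases a with _ | _ | a
    · rw [h0, mul_assoc, ht, abs_lt]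
      rintro ⟨hl, hu⟩
      have hl' : (N : ℝ) < M := by linarith
      have hu' : (M : ℝ) < N + 1 := by linarith
      norm_cast at hl' hu'
      omega
    · by_cases hP : P k N
      · rw [zero_add, h1 k N hP, mul_assoc, ht, abs_lt]
        rintro ⟨hl, hu⟩
        have hl' : (N : ℝ) < M + 1 := by linarith
        have hu' : (M : ℝ) < N + 1 := by linarith
        norm_cast at hl' hu'
        obtain rfl : M = N := by omega
        exact hx2 hP
      · rw [zero_add, digitBall, if_neg one_ne_zero, if_pos rfl, if_neg hP]
        exact not_mem_basicBall_zero x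
    · rw [h2, abs_lt]
      rintro ⟨hl, hu⟩
      linarith
  · intro hx
    have hx0 : 0 ≤ x := by
      by_contra! hneg
      obtain ⟨m, hm⟩ := exists_nat_gt (-x)
      refine hx 2 0 m ((h2 0 0 m x).2 (abs_lt.2 ⟨?_, ?_⟩)) <;> linarith
    refine ⟨hx0, fun k => ?_⟩
    have hfl : (⌊(B : ℝ) ^ k * x⌋₊ : ℝ) + Int.fract ((B : ℝ) ^ k * x) = (B : ℝ) ^ k * x := by
      rw [natCast_floor_eq_intCast_floor (by positivity), Int.floor_add_fract]
    have hf0 := Int.fract_nonneg ((B : ℝ) ^ k * x)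
    have hf1 := Int.fract_lt_one ((B : ℝ) ^ k * x)
    have hle : Int.fract ((B : ℝ) ^ k * x) ≤ 1 / 2 := by
      by_contra! hgt
      refine hx 0 k ⌊(B : ℝ) ^ k * x⌋₊ ((h0 _ _ x).2 (abs_lt.2 ⟨?_, ?_⟩)) <;>
        linarith
    refine ⟨hle, fun hP => ?_⟩
    refine hx 1 k ⌊(B : ℝ) ^ k * x⌋₊ ((h1 _ _ hP x).2 (abs_lt.2 ⟨?_, ?_⟩)) <;>
      linarith

/-- The intervals `[N k, N k + 1/2] / B ^ k` are nested because the digits `d` lie below `B / 2`; a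
common point has integral parts `N k` and fractional parts at most one half. -/
theorem digitSet_nonempty {B : ℕ} (hB : 0 < B) {P : ℕ → ℕ → Prop} (N : ℕ → ℕ)
    (hN : ∀ k, ∃ d, 2 * d + 2 ≤ B ∧ N (k + 1) = B * N k + d) (hP : ∀ k, ¬ P k (N k)) :
    (digitSet B P).Nonempty := by
  have hB' : (0 : ℝ) < B := by exact_mod_cast hB
  have hpos : ∀ k : ℕ, (0 : ℝ) < (B : ℝ) ^ k := fun k => pow_pos hB' k
  let I : ℕ → Set ℝ := fun k => Set.Icc ((N k : ℝ) / B ^ k) ((N k + 1 / 2) / B ^ k)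
  have hanti : Antitone I := by
    refine antitone_nat_of_succ_le fun k => ?_
    obtain ⟨d, hd, hk⟩ := hN k
    have hd' : (2 * d + 2 : ℝ) ≤ B := by exact_mod_cast hd
    have hk' : (N (k + 1) : ℝ) = B * N k + d := by exact_mod_cast hk
    refine Set.Icc_subset_Icc ?_ ?_
    · rw [div_le_div_iff₀ (hpos _) (hpos _), hk', pow_succ]
      nlinarith [hpos k, mul_nonneg (Nat.cast_nonneg (α := ℝ) d) (hpos k).le]
    · rw [div_le_div_iff₀ (hpos _) (hpos _), hk', pow_succ]
      nlinarith [hpos k, mul_le_mul_of_nonneg_right hd' (hpos k).le]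
  have hne : ∀ k, (N k : ℝ) / B ^ k ≤ (N k + 1 / 2) / B ^ k := fun k =>
    div_le_div_of_nonneg_right (by linarith) (hpos k).le
  have hx := ciSup_mem_iInter_Icc_of_antitone_Icc hanti hne
  set x := ⨆ k, (N k : ℝ) / B ^ k
  have hmem : ∀ k, (N k : ℝ) ≤ B ^ k * x ∧ (B : ℝ) ^ k * x ≤ N k + 1 / 2 := fun k => by
    obtain ⟨hl, hu⟩ := Set.mem_iInter.1 hx k
    rw [div_le_iff₀ (hpos k)] at hl
    rw [le_div_iff₀ (hpos k)] at hu
    constructor <;> linarith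
  refine ⟨x, ?_, fun k => ?_⟩
  · have := (hmem 0).1
    rw [pow_zero, one_mul] at this
    exact (Nat.cast_nonneg _).trans this
  · obtain ⟨hl, hu⟩ := hmem k
    have h1 : ⌊(B : ℝ) ^ k * x⌋ = (N k : ℤ) := by
      rw [Int.floor_eq_iff]
      push_cast
      constructor <;> linarith
    have h2 : ⌊(B : ℝ) ^ k * x⌋₊ = N k := by
      rw [← Int.floor_toNat, h1, Int.toNat_natCast]
    rw [h2]
    refine ⟨?_, hP k⟩
    rw [Int.fract, h1]
    push_cast
    linarith

theorem floor_pow_succ_div {B : ℕ} (hB : 0 < B) (k : ℕ) (x : ℝ) :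
    ⌊(B : ℝ) ^ (k + 1) * x⌋₊ / B = ⌊(B : ℝ) ^ k * x⌋₊ := by
  have hB' : (0 : ℝ) < B := by exact_mod_cast hB
  rw [← Nat.floor_div_natCast]
  congr 1
  field_simp
  ring

theorem floor_pow_div_pow {B : ℕ} (hB : 0 < B) (k : ℕ) (x : ℝ) :
    ⌊(B : ℝ) ^ k * x⌋₊ / B ^ k = ⌊x⌋₊ := by
  have hB' : (0 : ℝ) < B := by exact_mod_cast hB
  have h := Nat.floor_div_natCast ((B : ℝ) ^ k * x) (B ^ k)
  rw [← h]
  congr 1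
  push_cast
  field_simp

/-- The integral part of `B ^ k * q + 1 / 4` for the rational number `q` with index `c`. -/
def floorIndex (B k c : ℕ) : ℕ :=
  (4 * B ^ k * c.unpair.1.unpair.1 + (c.unpair.2 + 1) - 4 * B ^ k * c.unpair.1.unpair.2) /
    (4 * (c.unpair.2 + 1))

/-- `B ^ k * x` lies in `[M, M + 1/2]` for its integral part `M`. An approximation with error at
most `1/8`, shifted by `1/4`, lies in `[M + 1/8, M + 7/8]` and so still has integral part `M`. -/
theorem floorIndex_eq {B : ℕ} {P : ℕ → ℕ → Prop} {x : ℝ} (hx : x ∈ digitSet B P) {k c : ℕ}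
    (hc : |(ratEnum c : ℝ) - x| * B ^ k ≤ 1 / 8) :
    floorIndex B k c = ⌊(B : ℝ) ^ k * x⌋₊ := by
  obtain ⟨hx0, hx⟩ := hx
  have hfl : (⌊(B : ℝ) ^ k * x⌋₊ : ℝ) + Int.fract ((B : ℝ) ^ k * x) = (B : ℝ) ^ k * x := by
    rw [natCast_floor_eq_intCast_floor (by positivity), Int.floor_add_fract]
  have hf0 := Int.fract_nonneg ((B : ℝ) ^ k * x)
  have hf1 := (hx k).1
  set M := ⌊(B : ℝ) ^ k * x⌋₊
  set u := c.unpair.1.unpair.1 with hu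
  set v := c.unpair.1.unpair.2 with hv
  set w := c.unpair.2 + 1 with hw
  have hw0 : (0 : ℝ) < w := by rw [hw]; positivity
  have hq : (ratEnum c : ℝ) = ((u : ℝ) - v) / w := by
    rw [ratEnum, ← hu, ← hv, hw]; push_cast; rfl
  have hb : |((u : ℝ) - v) * B ^ k - B ^ k * x * w| ≤ 1 / 8 * w := by
    have h1 : ((u : ℝ) - v) * B ^ k - B ^ k * x * w = (ratEnum c - x) * B ^ k * w := by
      rw [hq]; field_simp
    rw [h1, abs_mul, abs_mul, abs_of_pos hw0, abs_of_nonneg (show (0 : ℝ) ≤ B ^ k by positivity)]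
    exact mul_le_mul_of_nonneg_right hc hw0.le
  rw [← hfl, abs_le] at hb
  -- This bound also shows that the truncated subtraction in `floorIndex` is a true one.
  have hlow : (M * (4 * w) + 4 * B ^ k * v : ℝ) ≤ 4 * B ^ k * u + w := by nlinarith
  have hupp : (4 * B ^ k * u + w : ℝ) < (M + 1) * (4 * w) + 4 * B ^ k * v := by nlinarith
  norm_cast at hlow hupp
  rw [floorIndex, ← hu, ← hv, ← hw]
  have hw1 : 0 < w := Nat.succ_pos _
  rw [Nat.div_eq_iff (by omega)]
  generalize 4 * B ^ k * u = a at *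
  generalize 4 * B ^ k * v = b at *
  have h3 : (M + 1) * (4 * w) = M * (4 * w) + 4 * w := by ring
  constructor
  · omega
  · have h4 : M * (4 * w) = M * 4 * w := by ring
    omega

/-! ### Dyadic cells in Euclidean space -/

/-- The number whose binary digits are those at the places `j + i * (n + 1)`, `i < k`, of `N`. -/
def cellCoord (n j k N : ℕ) : ℕ :=
  ∑ i ∈ Finset.range k, 2 ^ i * (N / 2 ^ (j + i * (n + 1)) % 2)

/-- The lowest block of `n + 1` binary digits belongs to the latest subdivision; dividing by `2 ^ (n
+ 1)` passes to the parent cell. -/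
theorem cellCoord_succ (n j k N : ℕ) :
    cellCoord n j (k + 1) N = 2 * cellCoord n j k (N / 2 ^ (n + 1)) + N / 2 ^ j % 2 := by
  simp only [cellCoord, Finset.sum_range_succ', Finset.mul_sum]
  congr 1
  · refine Finset.sum_congr rfl fun i _ => ?_
    rw [Nat.div_div_eq_div_mul, ← pow_add, pow_succ]
    ring_nf
  · simp

/-- The index of the least corner of the cell with number `N` in the subdivision of the cube
`[-S, S] ^ n` into `2 ^ (k * n)` cells. -/
def cellCorner (n S k N : ℕ) : ℕ :=
  encode (List.ofFn fun j : Fin n =>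
    Nat.pair (Nat.pair (2 * S * cellCoord n j k N) (S * 2 ^ k)) (2 ^ k - 1))

theorem ratPoint_cellCorner (n S k N : ℕ) (j : Fin n) :
    ratPoint n (cellCorner n S k N) j = 2 * S * (cellCoord n j k N / 2 ^ k) - S := by
  have hden : ((2 ^ k - 1 : ℕ) : ℝ) + 1 = 2 ^ k := by
    exact_mod_cast Nat.sub_add_cancel (Nat.one_le_two_pow)
  have h : (List.ofFn fun j : Fin n =>
      Nat.pair (Nat.pair (2 * S * cellCoord n j k N) (S * 2 ^ k)) (2 ^ k - 1)).getD j 0 =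
      Nat.pair (Nat.pair (2 * S * cellCoord n j k N) (S * 2 ^ k)) (2 ^ k - 1) := by
    simp [List.getD]
  simp only [ratPoint, cellCorner, ofNat_encode, h, ratEnum, Nat.unpair_pair]
  push_cast
  rw [hden]
  field_simp

/-- The point `y` lies in the closed cell with number `N`. -/
def InCell (n S k N : ℕ) (y : EuclideanSpace ℝ (Fin n)) : Prop :=
  ∀ j : Fin n, 2 * S * (cellCoord n j k N / 2 ^ k) - S ≤ y j ∧
    y j ≤ 2 * S * (cellCoord n j k N / 2 ^ k) - S + 2 * S / 2 ^ k

/-- An upper bound for the diameter of the cells. -/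
noncomputable def cellSize (n S k : ℕ) : ℝ := 2 * n * S / 2 ^ k

theorem cellSize_nonneg (n S k : ℕ) : 0 ≤ cellSize n S k := by unfold cellSize; positivity

/-- The diameter is `√n` times the side length `2 * S / 2 ^ k`; bounding `√n` by `n` keeps
`cellSize` rational. -/
theorem InCell.dist_le {n S k N : ℕ} {y : EuclideanSpace ℝ (Fin n)} (h : InCell n S k N y) :
    dist (ratPoint n (cellCorner n S k N)) y ≤ cellSize n S k := by
  rw [EuclideanSpace.dist_eq, Real.sqrt_le_left (cellSize_nonneg n S k)]
  have h1 : ∀ j ∈ Finset.univ, dist (ratPoint n (cellCorner n S k N) j) (y j) ^ 2 ≤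
      (2 * S / 2 ^ k : ℝ) ^ 2 := fun j _ => by
    rw [ratPoint_cellCorner, Real.dist_eq, sq_abs]
    obtain ⟨hl, hu⟩ := h j
    exact sq_le_sq' (by linarith) (by linarith [show (0 : ℝ) ≤ 2 * S / 2 ^ k by positivity])
  refine (Finset.sum_le_sum h1).trans ?_
  rw [Finset.sum_const, Finset.card_univ, Fintype.card_fin, nsmul_eq_mul]
  have h2 : cellSize n S k = n * (2 * S / 2 ^ k) := by rw [cellSize]; ring
  rw [h2, mul_pow]
  refine mul_le_mul_of_nonneg_right ?_ (by positivity)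
  norm_cast
  nlinarith [Nat.le_mul_self n]

/-- In each coordinate the cells form nested compact intervals. No bound on the digits is needed,
since `cellCoord` ignores the top bit of every block. -/
theorem exists_inCell_of_forall_div_eq (n S : ℕ) {N : ℕ → ℕ}
    (hN : ∀ k, N (k + 1) / 2 ^ (n + 1) = N k) :
    ∃ y : EuclideanSpace ℝ (Fin n), ∀ k, InCell n S k (N k) y := by
  have key : ∀ j : Fin n, ∃ t : ℝ, ∀ k, (cellCoord n j k (N k) : ℝ) / 2 ^ k ≤ t ∧
      t ≤ (cellCoord n j k (N k) + 1) / 2 ^ k := fun j => by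
    let I : ℕ → Set ℝ := fun k =>
      Set.Icc ((cellCoord n j k (N k) : ℝ) / 2 ^ k) ((cellCoord n j k (N k) + 1) / 2 ^ k)
    have hanti : Antitone I := by
      refine antitone_nat_of_succ_le fun k => ?_
      have h1 : cellCoord n j (k + 1) (N (k + 1)) =
          2 * cellCoord n j k (N k) + N (k + 1) / 2 ^ (j : ℕ) % 2 := by
        rw [cellCoord_succ, hN]
      have h2 : ((N (k + 1) / 2 ^ (j : ℕ) % 2 : ℕ) : ℝ) ≤ 1 := by
        exact_mod_cast Nat.le_of_lt_succ (Nat.mod_lt _ two_pos)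
      have h3 : (cellCoord n j (k + 1) (N (k + 1)) : ℝ) =
          2 * cellCoord n j k (N k) + (N (k + 1) / 2 ^ (j : ℕ) % 2 : ℕ) := by exact_mod_cast h1
      have h4 : (0 : ℝ) < 2 ^ k := by positivity
      refine Set.Icc_subset_Icc ?_ ?_
      · rw [div_le_div_iff₀ (by positivity) (by positivity), h3, pow_succ]
        nlinarith [mul_nonneg (Nat.cast_nonneg (α := ℝ) (N (k + 1) / 2 ^ (j : ℕ) % 2)) h4.le]
      · rw [div_le_div_iff₀ (by positivity) (by positivity), h3, pow_succ]
        nlinarith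
    have hx := ciSup_mem_iInter_Icc_of_antitone_Icc hanti fun k =>
      div_le_div_of_nonneg_right (by linarith) (by positivity)
    exact ⟨_, fun k => Set.mem_iInter.1 hx k⟩
  choose t ht using key
  refine ⟨WithLp.toLp 2 fun j => 2 * S * t j - S, fun k j => ?_⟩
  obtain ⟨hl, hu⟩ := ht j k
  have hS : (0 : ℝ) ≤ 2 * S := by positivity
  have h1 := mul_le_mul_of_nonneg_left hl hS
  have h2 := mul_le_mul_of_nonneg_left hu hS
  rw [add_div, mul_add, mul_one_div] at h2
  constructor <;> dsimp only <;> linarith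

/-- The `k`-th digit collects the `(k + 1)`-st binary digits of the numbers `(y j + S) / (2 * S)`,
so it is below `2 ^ n`, half of the base. The leading part `m` is free because stage `k` reads only
the lowest `k` blocks. -/
theorem exists_digits_inCell {n S : ℕ} {y : EuclideanSpace ℝ (Fin n)} (hy : ∀ j, |y j| < S)
    (m : ℕ) :
    ∃ N : ℕ → ℕ, N 0 = m ∧
      (∀ k, ∃ d, 2 * d + 2 ≤ 2 ^ (n + 1) ∧ N (k + 1) = 2 ^ (n + 1) * N k + d) ∧
      ∀ k, InCell n S k (N k) y := by
  let A : Fin n → ℕ → ℕ := fun j k => ⌊((2 : ℕ) : ℝ) ^ k * ((y j + S) / (2 * S))⌋₊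
  let d : ℕ → ℕ := fun k => Nat.ofBits fun j : Fin n => decide (A j (k + 1) % 2 = 1)
  let N : ℕ → ℕ := fun k => Nat.rec m (fun i r => 2 ^ (n + 1) * r + d i) k
  have hNs : ∀ k, N (k + 1) = 2 ^ (n + 1) * N k + d k := fun k => rfl
  have hd : ∀ k, d k < 2 ^ n := fun k => Nat.ofBits_lt_two_pow _
  have hdiv : ∀ k, N (k + 1) / 2 ^ (n + 1) = N k := fun k => by
    have := hd k
    rw [hNs, Nat.mul_add_div (by positivity), Nat.div_eq_of_lt (by rw [pow_succ]; omega), add_zero]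
  have hbit : ∀ k, ∀ j : Fin n, N (k + 1) / 2 ^ (j : ℕ) % 2 = A j (k + 1) % 2 := fun k j => by
    have h1 : (N (k + 1)).testBit j = (d k).testBit j := by
      have h2 : d k < 2 ^ (n + 1) := (hd k).trans (Nat.pow_lt_pow_right one_lt_two n.lt_succ_self)
      rw [hNs, Nat.testBit_two_pow_mul_add _ h2, if_pos (by omega)]
    have h2 : (d k).testBit j = decide (A j (k + 1) % 2 = 1) :=
      Nat.testBit_ofBits_lt _ _ j.2
    rw [h2, Nat.testBit_eq_decide_div_mod_eq, decide_eq_decide] at h1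
    omega
  have hA : ∀ j : Fin n, ∀ k, cellCoord n j k (N k) = A j k := fun j k => by
    have hS : (0 : ℝ) < S := (abs_nonneg _).trans_lt (hy j)
    have ha := abs_lt.1 (hy j)
    induction k with
    | zero =>
      have : (y j + S) / (2 * S) < 1 := by
        rw [div_lt_one (by positivity)]; linarith
      simpa [cellCoord, A] using (Nat.floor_eq_zero.2 this).symm
    | succ k ih =>
      have h1 : A j (k + 1) / 2 = A j k := floor_pow_succ_div two_pos k _
      rw [cellCoord_succ, hdiv, ih, hbit]
      omega
  refine ⟨N, rfl, fun k => ⟨d k, ?_, hNs k⟩, fun k j => ?_⟩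
  · have := hd k
    rw [pow_succ]
    omega
  · rw [hA]
    have hS : (0 : ℝ) < S := (abs_nonneg _).trans_lt (hy j)
    have ha := abs_lt.1 (hy j)
    have h0 : 0 ≤ (y j + S) / (2 * S) := div_nonneg (by linarith) (by positivity)
    have h1 := Nat.floor_le (show 0 ≤ ((2 : ℕ) : ℝ) ^ k * ((y j + S) / (2 * S)) by positivity)
    have h2 := Nat.lt_floor_add_one (((2 : ℕ) : ℝ) ^ k * ((y j + S) / (2 * S)))
    change (A j k : ℝ) ≤ _ at h1
    change _ < (A j k : ℝ) + 1 at h2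
    have h3 : y j + S = 2 * S * ((y j + S) / (2 * S)) := by field_simp
    have h4 : (A j k : ℝ) / 2 ^ k ≤ (y j + S) / (2 * S) := by
      rw [div_le_iff₀ (by positivity)]
      push_cast at h1
      linarith
    have h5 : (y j + S) / (2 * S) ≤ (A j k : ℝ) / 2 ^ k + 1 / 2 ^ k := by
      rw [← add_div, le_div_iff₀ (by positivity)]
      push_cast at h2
      linarith
    have h6 := mul_le_mul_of_nonneg_left h4 (show (0 : ℝ) ≤ 2 * S by positivity)
    have h7 := mul_le_mul_of_nonneg_left h5 (show (0 : ℝ) ≤ 2 * S by positivity)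
    rw [mul_add, mul_one_div] at h7
    constructor <;> linarith

theorem tendsto_cellSize (n S : ℕ) :
    Filter.Tendsto (cellSize n S) Filter.atTop (𝓝 0) := by
  have h := (tendsto_pow_atTop_nhds_zero_of_lt_one (r := (2⁻¹ : ℝ)) (by norm_num)
    (by norm_num)).const_mul (2 * n * S : ℝ)
  rw [mul_zero] at h
  refine h.congr fun k => ?_
  rw [cellSize, inv_pow, div_eq_mul_inv]

theorem cellSize_le (n S i : ℕ) : cellSize n S (i + 1 + 2 * n * S) ≤ 2⁻¹ ^ (i + 1) := by
  rw [cellSize, inv_pow, pow_add _ (i + 1), div_le_iff₀ (by positivity),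
    inv_mul_cancel_left₀ (by positivity)]
  exact_mod_cast (Nat.lt_two_pow_self (n := 2 * n * S)).le

/-- By `2 * n * S < 2 ^ (2 * n * S)`, going `2 * n * S` stages deeper absorbs the size of the cube,
so the `i`-th corner is within `2⁻¹ ^ (i + 1)` of `y`. -/
theorem cauchyRep_names_cellCorner {n S : ℕ} {N : ℕ → ℕ} {y : EuclideanSpace ℝ (Fin n)}
    (h : ∀ k, InCell n S k (N k) y) :
    (cauchyRep (EuclideanSpace ℝ (Fin n))).Names
      (fun i => cellCorner n S (i + 1 + 2 * n * S) (N (i + 1 + 2 * n * S))) y := by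
  have hd : ∀ i, dist (ratPoint n (cellCorner n S (i + 1 + 2 * n * S) (N (i + 1 + 2 * n * S)))) y ≤
      2⁻¹ ^ (i + 1) := fun i => (h _).dist_le.trans (cellSize_le n S i)
  refine ⟨fun i j hij => ?_, ?_⟩
  · have h1 := dist_triangle_right
      (ratPoint n (cellCorner n S (i + 1 + 2 * n * S) (N (i + 1 + 2 * n * S))))
      (ratPoint n (cellCorner n S (j + 1 + 2 * n * S) (N (j + 1 + 2 * n * S)))) y
    have h2 : (2⁻¹ : ℝ) ^ (j + 1) ≤ 2⁻¹ ^ (i + 1) :=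
      pow_le_pow_of_le_one (by norm_num) (by norm_num) (by omega)
    have h3 : (2⁻¹ : ℝ) ^ (i + 1) + 2⁻¹ ^ (i + 1) = 2⁻¹ ^ i := by ring
    exact h1.trans (by linarith [hd i, hd j])
  · rw [tendsto_iff_dist_tendsto_zero]
    have h0 : Filter.Tendsto (fun i : ℕ => (2⁻¹ : ℝ) ^ (i + 1)) Filter.atTop (𝓝 0) :=
      (tendsto_pow_atTop_nhds_zero_of_lt_one (by norm_num) (by norm_num)).comp
        (Filter.tendsto_add_atTop_nat 1)
    exact squeeze_zero (fun _ => dist_nonneg) hd h0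

/-! ### The tree of approximate projection points -/

/-- The index in the enumeration of all rational numbers of the nonnegative rational number with
index `m`. -/
def nnratIndex (m : ℕ) : ℕ := Nat.pair (Nat.pair m.unpair.1 0) m.unpair.2

theorem ratEnum_nnratIndex (m : ℕ) : ratEnum (nnratIndex m) = nnratEnum m := by
  simp [ratEnum, nnratIndex, nnratEnum]

/-- The index of the product of two enumerated rational numbers. -/
def mulIndex (a b : ℕ) : ℕ :=
  Nat.pair (Nat.pair
    (a.unpair.1.unpair.1 * b.unpair.1.unpair.1 + a.unpair.1.unpair.2 * b.unpair.1.unpair.2)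
    (a.unpair.1.unpair.1 * b.unpair.1.unpair.2 + a.unpair.1.unpair.2 * b.unpair.1.unpair.1))
    ((a.unpair.2 + 1) * (b.unpair.2 + 1) - 1)

theorem ratEnum_mulIndex (a b : ℕ) : ratEnum (mulIndex a b) = ratEnum a * ratEnum b := by
  have h : (((a.unpair.2 + 1) * (b.unpair.2 + 1) - 1 : ℕ) : ℚ) + 1 =
      (a.unpair.2 + 1) * (b.unpair.2 + 1) := by
    exact_mod_cast Nat.sub_add_cancel (show 1 ≤ (a.unpair.2 + 1) * (b.unpair.2 + 1) by
      exact Nat.mul_pos (Nat.succ_pos _) (Nat.succ_pos _))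
  simp only [ratEnum, mulIndex, Nat.unpair_pair, h]
  push_cast
  field_simp
  ring

theorem nnratEnum_nonneg (m : ℕ) : 0 ≤ nnratEnum m := by unfold nnratEnum; positivity

theorem exists_nnratEnum_eq {q : ℚ} (hq : 0 ≤ q) : ∃ m, nnratEnum m = q := by
  refine ⟨Nat.pair q.num.toNat (q.den - 1), ?_⟩
  have h1 : ((q.den - 1 : ℕ) : ℚ) + 1 = q.den := by
    exact_mod_cast Nat.sub_add_cancel q.den_pos
  have h2 : ((q.num.toNat : ℕ) : ℚ) = q.num := by
    exact_mod_cast Int.toNat_of_nonneg (Rat.num_nonneg.2 hq)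
  simp only [nnratEnum, Nat.unpair_pair]
  rw [h1, h2, Rat.num_div_den]

theorem ratPoint_zero (n : ℕ) : ratPoint n 0 = 0 := by
  ext j
  have h : Denumerable.ofNat (List ℕ) 0 = [] := by simp
  simp [ratPoint, h, ratEnum]

theorem div_pow_eq_of_digits {B : ℕ} {N : ℕ → ℕ}
    (hN : ∀ k, ∃ d, 2 * d + 2 ≤ B ∧ N (k + 1) = B * N k + d) (k : ℕ) : N k / B ^ k = N 0 := by
  induction k with
  | zero => simp
  | succ k ih =>
    obtain ⟨d, hd, hk⟩ := hN k
    rw [hk, pow_succ', ← Nat.div_div_eq_div_mul, Nat.mul_add_div (by omega),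
      Nat.div_eq_of_lt (show d < B by omega), add_zero, ih]

/-- For a joint name `f` of a point `x` and a closed set `A`: at stage `k` it is recognized that
the cell with number `N` contains no point of `A` whose distance from `x` is at most the rational
number with index `r`. -/
def CellBad (n : ℕ) (f : ℕ → ℕ) (S r k N : ℕ) : Prop :=
  (∃ i < k, dist (ratPoint n (f (2 * i + 1)).unpair.1) (ratPoint n (cellCorner n S k N)) <
    nnratEnum (f (2 * i + 1)).unpair.2 - cellSize n S k) ∨
  ¬ dist (ratPoint n (f (2 * k))) (ratPoint n (cellCorner n S k N)) <
    ratEnum r + 2 * 2⁻¹ ^ k + cellSize n S k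

/-- For a joint name `f` of a point `x` and a closed set `A`: at stage `t` it is recognized that
the distance of `x` from `A` is at least the rational number with index `q`. -/
def FarCert (n : ℕ) (f : ℕ → ℕ) (S q t : ℕ) : Prop :=
  q.unpair.1 = 0 ∨
    ((∀ N < (2 ^ (n + 1)) ^ t, CellBad n f S (nnratIndex q) t N) ∧
      dist (ratPoint n (f (2 * t))) (ratPoint n 0) < S - nnratEnum q - 2⁻¹ ^ t)

/-- The cells to be removed: a number `N` of a cell at stage `k` carries, besides the binary
digits of the cell, the size `S` of the surrounding cube, a radius `q` and a stage `t` at which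
`q` is recognized as a lower bound of the distance. -/
def TreeBad (n u : ℕ) (f : ℕ → ℕ) (k N : ℕ) : Prop :=
  ¬ FarCert n f (N / (2 ^ (n + 1)) ^ k).unpair.1 (N / (2 ^ (n + 1)) ^ k).unpair.2.unpair.1
      (N / (2 ^ (n + 1)) ^ k).unpair.2.unpair.2 ∨
    CellBad n f (N / (2 ^ (n + 1)) ^ k).unpair.1
      (mulIndex u (nnratIndex (N / (2 ^ (n + 1)) ^ k).unpair.2.unpair.1)) k N

section Names

variable {n : ℕ} {f : ℕ → ℕ} {x : EuclideanSpace ℝ (Fin n)} {A : Set (EuclideanSpace ℝ (Fin n))}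

/-- Soundness of the removal of cells. Of the slack `2 * 2⁻¹ ^ k` in `CellBad`, one half pays for
the approximation of `x` and the other makes the inequality strict, so a point at distance exactly
`r` is never removed. -/
theorem CellBad.not_mem_or_lt
    (hx : ∀ i, dist (ratPoint n (f (2 * i))) x ≤ 2⁻¹ ^ i)
    (hA : A = (⋃ i, basicBall (f (2 * i + 1)))ᶜ) {S r k N : ℕ} (h : CellBad n f S r k N)
    {y : EuclideanSpace ℝ (Fin n)} (hy : InCell n S k N y) :
    y ∉ A ∨ (ratEnum r : ℝ) < dist x y := by
  rcases h with ⟨i, -, hi⟩ | h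
  · left
    rw [hA, Set.mem_compl_iff, not_not, Set.mem_iUnion]
    refine ⟨i, Metric.mem_ball'.2 ?_⟩
    have := dist_triangle (ratPoint n (f (2 * i + 1)).unpair.1)
      (ratPoint n (cellCorner n S k N)) y
    change dist (ratPoint n _) y < _
    linarith [hy.dist_le]
  · right
    have h1 := dist_triangle4 (ratPoint n (f (2 * k))) x y (ratPoint n (cellCorner n S k N))
    rw [dist_comm y] at h1
    have h2 : (0 : ℝ) < 2⁻¹ ^ k := by positivity
    linarith [hy.dist_le, hx k]

/-- Completeness: as cell sizes and errors tend to zero, a point outside `A` eventually has its cell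
well inside a removed ball, and the distance tests pass to the limit. -/
theorem mem_and_dist_le_of_forall_not_cellBad
    (hx : ∀ i, dist (ratPoint n (f (2 * i))) x ≤ 2⁻¹ ^ i)
    (hA : A = (⋃ i, basicBall (f (2 * i + 1)))ᶜ) {S r : ℕ} {N : ℕ → ℕ}
    (h : ∀ k, ¬ CellBad n f S r k (N k)) {y : EuclideanSpace ℝ (Fin n)}
    (hy : ∀ k, InCell n S k (N k) y) : y ∈ A ∧ dist x y ≤ ratEnum r := by
  have h2 : Filter.Tendsto (fun i : ℕ => (2⁻¹ : ℝ) ^ i) Filter.atTop (𝓝 0) :=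
    tendsto_pow_atTop_nhds_zero_of_lt_one (by norm_num) (by norm_num)
  constructor
  · by_contra hyA
    rw [hA, Set.mem_compl_iff, not_not, Set.mem_iUnion] at hyA
    obtain ⟨i, hi⟩ := hyA
    have hi' : dist (ratPoint n (f (2 * i + 1)).unpair.1) y <
      nnratEnum (f (2 * i + 1)).unpair.2 := Metric.mem_ball'.1 hi
    have h3 := (tendsto_cellSize n S).const_mul 2
    rw [mul_zero] at h3
    obtain ⟨k, hk, hik⟩ := ((h3.eventually_lt_const (sub_pos.2 hi')).and
      (Filter.eventually_gt_atTop i)).exists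
    refine h k (Or.inl ⟨i, hik, ?_⟩)
    have h4 := dist_triangle_right (ratPoint n (f (2 * i + 1)).unpair.1)
      (ratPoint n (cellCorner n S k (N k))) y
    linarith [(hy k).dist_le]
  · have h3 := ((h2.const_mul 3).add ((tendsto_cellSize n S).const_mul 2)).const_add
      (ratEnum r : ℝ)
    rw [mul_zero, mul_zero, add_zero, add_zero] at h3
    refine ge_of_tendsto' h3 fun k => ?_
    have h4 := not_not.1 (not_or.1 (h k)).2
    have h5 := dist_triangle4 x (ratPoint n (f (2 * k))) (ratPoint n (cellCorner n S k (N k))) y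
    rw [dist_comm x (ratPoint n (f (2 * k)))] at h5
    linarith [(hy k).dist_le, hx k]

/-- A point of `A` closer to `x` than `q` would lie in the cube, hence in one of the finitely many
cells of stage `t`, all of which are bad. -/
theorem FarCert.le_infDist
    (hx : ∀ i, dist (ratPoint n (f (2 * i))) x ≤ 2⁻¹ ^ i)
    (hA : A = (⋃ i, basicBall (f (2 * i + 1)))ᶜ) (hne : A.Nonempty) {S q t : ℕ}
    (h : FarCert n f S q t) : (nnratEnum q : ℝ) ≤ Metric.infDist x A := by
  rcases h with h | ⟨h, hS⟩
  · simpa [nnratEnum, h] using Metric.infDist_nonneg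
  · refine (Metric.le_infDist hne).2 fun a ha => ?_
    by_contra! hlt
    have h0 : dist a 0 < S := by
      have h1 := dist_triangle4 a x (ratPoint n (f (2 * t))) 0
      rw [dist_comm a x, dist_comm x (ratPoint n _)] at h1
      rw [ratPoint_zero] at hS
      linarith [hx t]
    have h1 : ∀ j, |a j| < S := fun j => by
      rw [dist_zero_right] at h0
      exact (PiLp.norm_apply_le a j).trans_lt h0
    -- Leading part `0` puts the number of the cell at stage `t` below `(2 ^ (n + 1)) ^ t`.
    obtain ⟨N, hN0, hN, hcell⟩ := exists_digits_inCell h1 0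
    have hlt' : N t < (2 ^ (n + 1)) ^ t := by
      have h2 := div_pow_eq_of_digits hN t
      rw [hN0, Nat.div_eq_zero_iff] at h2
      exact h2.resolve_left (by positivity)
    rcases (h _ hlt').not_mem_or_lt hx hA (hcell t) with h2 | h2
    · exact h2 ha
    · rw [ratEnum_nnratIndex] at h2
      exact lt_asymm hlt h2

/-- Compactness: a closed ball of radius `q'` with `q < q' < d(x, A)` is covered by finitely many
removed balls with a uniform margin. The `2` in the bound on `S` pays for two errors `2⁻¹ ^ t ≤ 1`.
-/
theorem exists_farCert
    (hx : ∀ i, dist (ratPoint n (f (2 * i))) x ≤ 2⁻¹ ^ i)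
    (hA : A = (⋃ i, basicBall (f (2 * i + 1)))ᶜ) {q : ℕ}
    (hq : (nnratEnum q : ℝ) < Metric.infDist x A) {S : ℕ}
    (hS : dist x 0 + nnratEnum q + 2 < S) : ∃ t, FarCert n f S q t := by
  obtain ⟨q', hq1, hq2⟩ := exists_between hq
  -- Points inside one of the first `l` balls with margin `1 / (l + 1)`: an increasing family of
  -- open sets, so a single `l` suffices for the compact ball.
  let U : ℕ → Set (EuclideanSpace ℝ (Fin n)) := fun l => ⋃ i : Fin l,
    {c | dist (ratPoint n (f (2 * i + 1)).unpair.1) c + 1 / ((l : ℝ) + 1) <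
      nnratEnum (f (2 * i + 1)).unpair.2}
  have hUo : ∀ l, IsOpen (U l) := fun l => isOpen_iUnion fun i =>
    isOpen_lt (by fun_prop) continuous_const
  have hUm : Monotone U := by
    intro l m hlm c hc
    obtain ⟨i, hi⟩ := Set.mem_iUnion.1 hc
    refine Set.mem_iUnion.2 ⟨Fin.castLE hlm i, ?_⟩
    rw [Set.mem_ofPred_eq] at hi ⊢
    refine lt_of_le_of_lt ?_ hi
    have := one_div_le_one_div_of_le (show (0 : ℝ) < (l : ℝ) + 1 by positivity)
      (show (l : ℝ) + 1 ≤ (m : ℝ) + 1 by exact_mod_cast Nat.succ_le_succ hlm)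
    simpa using this
  have hcov : Metric.closedBall x q' ⊆ ⋃ l, U l := by
    intro c hc
    have hcA : c ∉ A := fun h => by
      have h1 := Metric.infDist_le_dist_of_mem (x := x) h
      rw [Metric.mem_closedBall, dist_comm] at hc
      linarith
    rw [hA, Set.mem_compl_iff, not_not, Set.mem_iUnion] at hcA
    obtain ⟨i, hi⟩ := hcA
    have hi' : dist (ratPoint n (f (2 * i + 1)).unpair.1) c <
      nnratEnum (f (2 * i + 1)).unpair.2 := Metric.mem_ball'.1 hi
    obtain ⟨l, hl, hil⟩ := ((tendsto_one_div_add_atTop_nhds_zero_nat (𝕜 := ℝ)).eventually_lt_const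
      (sub_pos.2 hi') |>.and (Filter.eventually_gt_atTop i)).exists
    refine Set.mem_iUnion.2 ⟨l, Set.mem_iUnion.2 ⟨⟨i, hil⟩, ?_⟩⟩
    rw [Set.mem_ofPred_eq]
    linarith
  obtain ⟨l, hl⟩ := (isCompact_closedBall x q').elim_directed_cover U hUo hcov
    hUm.directed_le
  have h2 : Filter.Tendsto (fun i : ℕ => (2⁻¹ : ℝ) ^ i) Filter.atTop (𝓝 0) :=
    tendsto_pow_atTop_nhds_zero_of_lt_one (by norm_num) (by norm_num)
  have h3 := (h2.const_mul 3).add (tendsto_cellSize n S)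
  rw [mul_zero, add_zero] at h3
  obtain ⟨t, ht1, ht2, ht3⟩ := ((h3.eventually_lt_const (sub_pos.2 hq1)).and
    (((tendsto_cellSize n S).eventually_lt_const
      (show (0 : ℝ) < 1 / ((l : ℝ) + 1) by positivity)).and
    (Filter.eventually_ge_atTop l))).exists
  refine ⟨t, Or.inr ⟨fun N _ => ?_, ?_⟩⟩
  -- A cell that is not far has its corner within `q'` of `x`, hence in `U l`; the margin exceeds
  -- `cellSize`, so the cell is bad after all.
  · by_contra hbad
    obtain ⟨hb1, hb2⟩ := not_or.1 hbad
    rw [not_not, ratEnum_nnratIndex] at hb2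
    have hc : ratPoint n (cellCorner n S t N) ∈ Metric.closedBall x q' := by
      rw [Metric.mem_closedBall, dist_comm]
      have := dist_triangle_left x (ratPoint n (cellCorner n S t N)) (ratPoint n (f (2 * t)))
      linarith [hx t]
    obtain ⟨i, hi⟩ := Set.mem_iUnion.1 (hl hc)
    refine hb1 ⟨i, i.2.trans_le ht3, ?_⟩
    rw [Set.mem_ofPred_eq] at hi
    linarith
  · have h4 : (2⁻¹ : ℝ) ^ t ≤ 1 := pow_le_one₀ (by norm_num) (by norm_num)
    have h5 := dist_triangle (ratPoint n (f (2 * t))) x 0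
    rw [ratPoint_zero]
    linarith [hx t]

theorem digitSet_treeBad_nonempty
    (hx : ∀ i, dist (ratPoint n (f (2 * i))) x ≤ 2⁻¹ ^ i)
    (hA : A = (⋃ i, basicBall (f (2 * i + 1)))ᶜ) (hne : A.Nonempty) {u : ℕ}
    (hu : 1 < ratEnum u) : (digitSet (2 ^ (n + 1)) (TreeBad n u f)).Nonempty := by
  have hcl : IsClosed A := by
    rw [hA]
    exact (isOpen_iUnion fun i => Metric.isOpen_ball).isClosed_compl
  have hu' : (1 : ℝ) < ratEnum u := by exact_mod_cast hu
  obtain ⟨S, q, t, y, hcert, hyA, hyS, hyq⟩ : ∃ S q t, ∃ y : EuclideanSpace ℝ (Fin n),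
      FarCert n f S q t ∧ y ∈ A ∧ (∀ j, |y j| < S) ∧
        dist x y ≤ ratEnum (mulIndex u (nnratIndex q)) := by
    have hbd : ∀ (y : EuclideanSpace ℝ (Fin n)) (S : ℕ), ‖y‖ < S → ∀ j, |y j| < S :=
      fun y S h j => (PiLp.norm_apply_le y j).trans_lt h
    by_cases hxA : x ∈ A
    · obtain ⟨S, hS⟩ := exists_nat_gt ‖x‖
      -- Index `0` codes radius `0`, which needs no certificate.
      refine ⟨S, 0, 0, x, Or.inl (by simp), hxA, hbd x S hS, ?_⟩
      rw [ratEnum_mulIndex, ratEnum_nnratIndex]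
      simp [nnratEnum]
    · have hpos : 0 < Metric.infDist x A := (hcl.notMem_iff_infDist_pos hne).1 hxA
      obtain ⟨y, hyA, hy⟩ := hcl.exists_infDist_eq_dist hne x
      -- Below `d(x, A)` the radius gets certified; above `d(x, A) / u` the nearest point `y` stays
      -- within `u * q`.
      obtain ⟨a, ha1, ha2⟩ := exists_rat_btwn (div_lt_self hpos hu')
      have ha0 : (0 : ℝ) < a := (div_pos hpos (by linarith)).trans ha1
      obtain ⟨q, hq⟩ := exists_nnratEnum_eq (q := a) (by exact_mod_cast ha0.le)
      rw [← hq] at ha1 ha2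
      obtain ⟨S, hS⟩ := exists_nat_gt (max ‖y‖ (dist x 0 + nnratEnum q + 2))
      obtain ⟨t, ht⟩ := exists_farCert hx hA ha2 ((le_max_right _ _).trans_lt hS)
      refine ⟨S, q, t, y, ht, hyA, hbd y S ((le_max_left _ _).trans_lt hS), ?_⟩
      rw [ratEnum_mulIndex, ratEnum_nnratIndex, ← hy]
      push_cast
      rw [div_lt_iff₀ (by linarith)] at ha1
      linarith
  obtain ⟨N, hN0, hN, hcell⟩ := exists_digits_inCell hyS (Nat.pair S (Nat.pair q t))
  have hdiv : ∀ k, N k / (2 ^ (n + 1)) ^ k = Nat.pair S (Nat.pair q t) := fun k =>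
    (div_pow_eq_of_digits hN k).trans hN0
  refine digitSet_nonempty (by positivity) N hN fun k hbad => ?_
  rw [TreeBad, hdiv] at hbad
  simp only [Nat.unpair_pair] at hbad
  rcases hbad with h | h
  · exact h hcert
  · rcases h.not_mem_or_lt hx hA (hcell k) with h | h
    · exact h hyA
    · exact h.not_ge hyq

/-- The integral part of `z` reappears at every stage as the leading part, so all stages test the
same `(S, q, t)`. The cells give `d(x, y) ≤ u * q`, and the certificate gives `q ≤ d(x, A)`. -/
theorem exists_approxProj_of_mem_digitSet
    (hx : ∀ i, dist (ratPoint n (f (2 * i))) x ≤ 2⁻¹ ^ i)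
    (hA : A = (⋃ i, basicBall (f (2 * i + 1)))ᶜ) (hne : A.Nonempty) {u : ℕ} {ε : ℝ}
    (hu0 : 0 ≤ ratEnum u) (hu : (ratEnum u : ℝ) ≤ 1 + ε) {z : ℝ}
    (hz : z ∈ digitSet (2 ^ (n + 1)) (TreeBad n u f)) :
    ∃ y ∈ A, dist x y ≤ (1 + ε) * Metric.infDist x A ∧
      ∀ k, InCell n ⌊z⌋₊.unpair.1 k ⌊((2 ^ (n + 1) : ℕ) : ℝ) ^ k * z⌋₊ y := by
  obtain ⟨hz0, hz⟩ := hz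
  have hB : 0 < 2 ^ (n + 1) := by positivity
  obtain ⟨y, hy⟩ := exists_inCell_of_forall_div_eq n ⌊z⌋₊.unpair.1
    (N := fun k => ⌊((2 ^ (n + 1) : ℕ) : ℝ) ^ k * z⌋₊) fun k => floor_pow_succ_div hB k z
  have h : ∀ k, FarCert n f ⌊z⌋₊.unpair.1 ⌊z⌋₊.unpair.2.unpair.1 ⌊z⌋₊.unpair.2.unpair.2 ∧
      ¬ CellBad n f ⌊z⌋₊.unpair.1 (mulIndex u (nnratIndex ⌊z⌋₊.unpair.2.unpair.1)) k
        ⌊((2 ^ (n + 1) : ℕ) : ℝ) ^ k * z⌋₊ := fun k => by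
    have h1 := (hz k).2
    rw [TreeBad, floor_pow_div_pow hB] at h1
    exact ⟨not_not.1 (not_or.1 h1).1, (not_or.1 h1).2⟩
  obtain ⟨hyA, hyd⟩ := mem_and_dist_le_of_forall_not_cellBad hx hA (fun k => (h k).2) hy
  refine ⟨y, hyA, hyd.trans ?_, hy⟩
  rw [ratEnum_mulIndex, ratEnum_nnratIndex]
  push_cast
  have h3 := (h 0).1.le_infDist hx hA hne
  have h4 : (0 : ℝ) ≤ nnratEnum ⌊z⌋₊.unpair.2.unpair.1 := by exact_mod_cast nnratEnum_nonneg _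
  have h5 : (0 : ℝ) ≤ ratEnum u := by exact_mod_cast hu0
  exact mul_le_mul hu h3 h4 (h5.trans hu)

end Names

/-! ### Primitive recursiveness of the tree -/

theorem primrec_two_pow : Primrec fun k : ℕ => 2 ^ k :=
  (Primrec₂.unpaired'.1 Nat.Primrec.pow).comp (.const 2) .id

/-- The index of the sum of two enumerated rational numbers. -/
def addIndex (a b : ℕ) : ℕ :=
  Nat.pair (Nat.pair
    (a.unpair.1.unpair.1 * (b.unpair.2 + 1) + b.unpair.1.unpair.1 * (a.unpair.2 + 1))
    (a.unpair.1.unpair.2 * (b.unpair.2 + 1) + b.unpair.1.unpair.2 * (a.unpair.2 + 1)))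
    ((a.unpair.2 + 1) * (b.unpair.2 + 1) - 1)

theorem ratEnum_addIndex (a b : ℕ) : ratEnum (addIndex a b) = ratEnum a + ratEnum b := by
  have h : (((a.unpair.2 + 1) * (b.unpair.2 + 1) - 1 : ℕ) : ℚ) + 1 =
      (a.unpair.2 + 1) * (b.unpair.2 + 1) := by
    exact_mod_cast Nat.sub_add_cancel (show 1 ≤ (a.unpair.2 + 1) * (b.unpair.2 + 1) by
      exact Nat.mul_pos (Nat.succ_pos _) (Nat.succ_pos _))
  simp only [ratEnum, addIndex, Nat.unpair_pair, h]
  push_cast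
  field_simp
  ring

/-- The index of the opposite of the nonnegative rational number with index `m`. -/
def negIndex (m : ℕ) : ℕ := Nat.pair (Nat.pair 0 m.unpair.1) m.unpair.2

theorem ratEnum_negIndex (m : ℕ) : ratEnum (negIndex m) = -nnratEnum m := by
  simp [ratEnum, negIndex, nnratEnum, neg_div]

/-- The index of the dyadic rational number `(a - b) / 2 ^ k`. -/
def dyadicIndex (a b k : ℕ) : ℕ := Nat.pair (Nat.pair a b) (2 ^ k - 1)

theorem ratEnum_dyadicIndex (a b k : ℕ) :
    ratEnum (dyadicIndex a b k) = ((a : ℚ) - b) / 2 ^ k := by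
  have hden : ((2 ^ k - 1 : ℕ) : ℚ) + 1 = 2 ^ k := by
    exact_mod_cast Nat.sub_add_cancel (Nat.one_le_two_pow)
  simp only [ratEnum, dyadicIndex, Nat.unpair_pair, hden]

section Primrec

variable {α : Type*} [Primcodable α] {f g h : α → ℕ}

theorem primrec_unpair_fst (hf : Primrec f) : Primrec fun z => (f z).unpair.1 :=
  Primrec.fst.comp (Primrec.unpair.comp hf)

theorem primrec_unpair_snd (hf : Primrec f) : Primrec fun z => (f z).unpair.2 :=
  Primrec.snd.comp (Primrec.unpair.comp hf)

theorem primrec_nnratIndex (hf : Primrec f) : Primrec fun z => nnratIndex (f z) :=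
  Primrec₂.natPair.comp (Primrec₂.natPair.comp (primrec_unpair_fst hf) (.const 0))
    (primrec_unpair_snd hf)

theorem primrec_negIndex (hf : Primrec f) : Primrec fun z => negIndex (f z) :=
  Primrec₂.natPair.comp (Primrec₂.natPair.comp (.const 0) (primrec_unpair_fst hf))
    (primrec_unpair_snd hf)

theorem primrec_dyadicIndex (hf : Primrec f) (hg : Primrec g) (hh : Primrec h) :
    Primrec fun z => dyadicIndex (f z) (g z) (h z) :=
  Primrec₂.natPair.comp (Primrec₂.natPair.comp hf hg)
    (Primrec.nat_sub.comp (primrec_two_pow.comp hh) (.const 1))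

theorem primrec_addIndex (hf : Primrec f) (hg : Primrec g) :
    Primrec fun z => addIndex (f z) (g z) := by
  have f1 := primrec_unpair_fst (primrec_unpair_fst hf)
  have f2 := primrec_unpair_snd (primrec_unpair_fst hf)
  have f3 := Primrec.succ.comp (primrec_unpair_snd hf)
  have g1 := primrec_unpair_fst (primrec_unpair_fst hg)
  have g2 := primrec_unpair_snd (primrec_unpair_fst hg)
  have g3 := Primrec.succ.comp (primrec_unpair_snd hg)
  exact Primrec₂.natPair.comp (Primrec₂.natPair.comp
    (Primrec.nat_add.comp (Primrec.nat_mul.comp f1 g3) (Primrec.nat_mul.comp g1 f3))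
    (Primrec.nat_add.comp (Primrec.nat_mul.comp f2 g3) (Primrec.nat_mul.comp g2 f3)))
    (Primrec.nat_sub.comp (Primrec.nat_mul.comp f3 g3) (.const 1))

theorem primrec_mulIndex (hf : Primrec f) (hg : Primrec g) :
    Primrec fun z => mulIndex (f z) (g z) := by
  have f1 := primrec_unpair_fst (primrec_unpair_fst hf)
  have f2 := primrec_unpair_snd (primrec_unpair_fst hf)
  have f3 := Primrec.succ.comp (primrec_unpair_snd hf)
  have g1 := primrec_unpair_fst (primrec_unpair_fst hg)
  have g2 := primrec_unpair_snd (primrec_unpair_fst hg)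
  have g3 := Primrec.succ.comp (primrec_unpair_snd hg)
  exact Primrec₂.natPair.comp (Primrec₂.natPair.comp
    (Primrec.nat_add.comp (Primrec.nat_mul.comp f1 g1) (Primrec.nat_mul.comp f2 g2))
    (Primrec.nat_add.comp (Primrec.nat_mul.comp f1 g2) (Primrec.nat_mul.comp f2 g1)))
    (Primrec.nat_sub.comp (Primrec.nat_mul.comp f3 g3) (.const 1))

/-- Squared distances of rational points are rational, so after checking that the bound is positive
the comparison becomes one between natural numbers, hence decidable exactly. -/
theorem dist_ratPoint_lt_iff (n i j r : ℕ) :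
    dist (ratPoint n i) (ratPoint n j) < ratEnum r ↔
      r.unpair.1.unpair.2 < r.unpair.1.unpair.1 ∧
      (sqDist i j n).1 * ((r.unpair.2 + 1) * (r.unpair.2 + 1)) <
        (r.unpair.1.unpair.1 - r.unpair.1.unpair.2) * (r.unpair.1.unpair.1 - r.unpair.1.unpair.2) *
          (sqDist i j n).2 := by
  have hM : (0 : ℝ) < (sqDist i j n).2 := by exact_mod_cast sqDist_pos i j n
  rw [sqDist_spec]
  set a := r.unpair.1.unpair.1 with ha
  set b := r.unpair.1.unpair.2 with hb
  have hw : (0 : ℝ) < (r.unpair.2 : ℝ) + 1 := by positivity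
  have hr : (ratEnum r : ℝ) = ((a : ℝ) - b) / (r.unpair.2 + 1) := by
    rw [ratEnum, ← ha, ← hb]; push_cast; rfl
  rw [hr]
  constructor
  · intro h
    have h0 : 0 < ((a : ℝ) - b) / (r.unpair.2 + 1) := (Real.sqrt_nonneg _).trans_lt h
    have h1 : (b : ℝ) < a := by
      have := (div_pos_iff_of_pos_right hw).1 h0
      linarith
    have h2 : b < a := by exact_mod_cast h1
    refine ⟨h2, ?_⟩
    rw [Real.sqrt_lt' h0, div_pow, div_lt_div_iff₀ hM (by positivity)] at h
    have h3 : ((a - b : ℕ) : ℝ) = a - b := Nat.cast_sub h2.le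
    rw [← h3] at h
    have : (sqDist i j n).1 * (r.unpair.2 + 1) ^ 2 < (a - b) ^ 2 * (sqDist i j n).2 := by
      exact_mod_cast h
    simpa only [sq] using this
  · rintro ⟨h2, h⟩
    have h1 : (b : ℝ) < a := by exact_mod_cast h2
    have h0 : 0 < ((a : ℝ) - b) / (r.unpair.2 + 1) := div_pos (by linarith) hw
    rw [Real.sqrt_lt' h0, div_pow, div_lt_div_iff₀ hM (by positivity)]
    have h3 : ((a - b : ℕ) : ℝ) = a - b := Nat.cast_sub h2.le
    rw [← h3]
    simp only [← sq] at h
    exact_mod_cast h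

theorem primrecPred_dist_ratPoint_lt (n : ℕ) (hf : Primrec f) (hg : Primrec g) (hh : Primrec h) :
    PrimrecPred fun z => dist (ratPoint n (f z)) (ratPoint n (g z)) < ratEnum (h z) := by
  have h1 := primrec_unpair_fst (primrec_unpair_fst hh)
  have h2 := primrec_unpair_snd (primrec_unpair_fst hh)
  have h3 := Primrec.succ.comp (primrec_unpair_snd hh)
  have h4 := Primrec.nat_sub.comp h1 h2
  have hd := (sqDist_primrec n).comp hf hg
  exact ((Primrec.nat_lt.comp h2 h1).and (Primrec.nat_lt.comp
    (Primrec.nat_mul.comp (Primrec.fst.comp hd) (Primrec.nat_mul.comp h3 h3))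
    (Primrec.nat_mul.comp (Primrec.nat_mul.comp h4 h4) (Primrec.snd.comp hd)))).of_eq fun z =>
      (dist_ratPoint_lt_iff n (f z) (g z) (h z)).symm

theorem primrec_cellCoord (n j : ℕ) (hf : Primrec f) (hg : Primrec g) :
    Primrec fun z => cellCoord n j (f z) (g z) := by
  have hi : Primrec fun w : α × ℕ × ℕ => w.2.1 := Primrec.fst.comp Primrec.snd
  have hs : Primrec₂ fun (z : α) (w : ℕ × ℕ) =>
      w.2 + 2 ^ w.1 * (g z / 2 ^ (j + w.1 * (n + 1)) % 2) :=
    Primrec.nat_add.comp (Primrec.snd.comp Primrec.snd) (Primrec.nat_mul.comp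
      (primrec_two_pow.comp hi) (Primrec.nat_mod.comp (Primrec.nat_div.comp
        (hg.comp Primrec.fst) (primrec_two_pow.comp (Primrec.nat_add.comp (.const j)
          (Primrec.nat_mul.comp hi (.const (n + 1)))))) (.const 2)))
  refine (Primrec.nat_rec' hf (.const 0) hs).of_eq fun z => ?_
  induction f z with
  | zero => simp [cellCoord]
  | succ k ih => rw [cellCoord, Finset.sum_range_succ, ← cellCoord, ← ih]

theorem primrec_cellCorner (n : ℕ) (hf : Primrec f) (hg : Primrec g) (hh : Primrec h) :
    Primrec fun z => cellCorner n (f z) (g z) (h z) :=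
  Primrec.encode.comp (Primrec.list_ofFn fun j : Fin n =>
    Primrec₂.natPair.comp (Primrec₂.natPair.comp
      (Primrec.nat_mul.comp (Primrec.nat_mul.comp (.const 2) hf) (primrec_cellCoord n j hg hh))
      (Primrec.nat_mul.comp hf (primrec_two_pow.comp hg)))
      (Primrec.nat_sub.comp (primrec_two_pow.comp hg) (.const 1)))

/-- All thresholds in `CellBad` are rational; writing them as indices reduces the tests to
comparisons of rational points. -/
theorem primrecPred_cellBad (n : ℕ) :
    PrimrecPred fun z : List ℕ × ℕ × ℕ × ℕ × ℕ =>
      CellBad n (fun i => z.1.getD i 0) z.2.1 z.2.2.1 z.2.2.2.1 z.2.2.2.2 := by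
  have getD : ∀ {β : Type} [Primcodable β] {l : β → List ℕ} {i : β → ℕ}, Primrec l → Primrec i →
      Primrec fun z => (l z).getD (i z) 0 := fun hl hi => (Primrec.list_getD 0).comp hl hi
  have hl : Primrec fun z : List ℕ × ℕ × ℕ × ℕ × ℕ => z.1 := Primrec.fst
  have h2 : Primrec fun z : List ℕ × ℕ × ℕ × ℕ × ℕ => z.2 := Primrec.snd
  have hS := Primrec.fst.comp h2
  have h3 := Primrec.snd.comp h2
  have hr := Primrec.fst.comp h3
  have h4 := Primrec.snd.comp h3
  have hk := Primrec.fst.comp h4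
  have hN := Primrec.snd.comp h4
  have hc := primrec_cellCorner n hS hk hN
  have hD := Primrec.nat_mul.comp (.const (2 * n)) hS
  have hball : PrimrecRel fun (i : ℕ) (z : List ℕ × ℕ × ℕ × ℕ × ℕ) =>
      dist (ratPoint n (z.1.getD (2 * i + 1) 0).unpair.1)
        (ratPoint n (cellCorner n z.2.1 z.2.2.2.1 z.2.2.2.2)) <
        ratEnum (addIndex (nnratIndex (z.1.getD (2 * i + 1) 0).unpair.2)
          (dyadicIndex 0 (2 * n * z.2.1) z.2.2.2.1)) := by
    have hb := getD (hl.comp Primrec.snd)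
      (Primrec.succ.comp (Primrec.nat_mul.comp (.const 2) Primrec.fst))
    exact primrecPred_dist_ratPoint_lt n (primrec_unpair_fst hb) (hc.comp Primrec.snd)
      (primrec_addIndex (primrec_nnratIndex (primrec_unpair_snd hb))
        (primrec_dyadicIndex (.const 0) (hD.comp Primrec.snd) (hk.comp Primrec.snd)))
  have hfar := primrecPred_dist_ratPoint_lt n (getD hl (Primrec.nat_mul.comp (.const 2) hk)) hc
    (primrec_addIndex hr (primrec_dyadicIndex (Primrec.nat_add.comp (.const 2) hD) (.const 0) hk))
  refine ((hball.exists_mem_list.comp (Primrec.list_range.comp hk) .id).or hfar.not).of_eq fun z => ?_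
  have e1 : ∀ i, (ratEnum (addIndex (nnratIndex (z.1.getD (2 * i + 1) 0).unpair.2)
      (dyadicIndex 0 (2 * n * z.2.1) z.2.2.2.1)) : ℝ) =
      nnratEnum (z.1.getD (2 * i + 1) 0).unpair.2 - cellSize n z.2.1 z.2.2.2.1 := fun i => by
    rw [ratEnum_addIndex, ratEnum_nnratIndex, ratEnum_dyadicIndex, cellSize]
    push_cast
    ring
  have e2 : (ratEnum (addIndex z.2.2.1 (dyadicIndex (2 + 2 * n * z.2.1) 0 z.2.2.2.1)) : ℝ) =
      ratEnum z.2.2.1 + 2 * 2⁻¹ ^ z.2.2.2.1 + cellSize n z.2.1 z.2.2.2.1 := by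
    rw [ratEnum_addIndex, ratEnum_dyadicIndex, cellSize, inv_pow]
    push_cast
    ring
  simp only [CellBad, e1, e2, id, List.mem_range]

theorem primrecPred_farCert (n : ℕ) :
    PrimrecPred fun z : List ℕ × ℕ × ℕ × ℕ =>
      FarCert n (fun i => z.1.getD i 0) z.2.1 z.2.2.1 z.2.2.2 := by
  have hl : Primrec fun z : List ℕ × ℕ × ℕ × ℕ => z.1 := Primrec.fst
  have h2 : Primrec fun z : List ℕ × ℕ × ℕ × ℕ => z.2 := Primrec.snd
  have hS := Primrec.fst.comp h2
  have h3 := Primrec.snd.comp h2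
  have hq := Primrec.fst.comp h3
  have ht := Primrec.snd.comp h3
  have hpow : Primrec fun z : List ℕ × ℕ × ℕ × ℕ => (2 ^ (n + 1)) ^ z.2.2.2 :=
    (Primrec₂.unpaired'.1 Nat.Primrec.pow).comp (.const _) ht
  have hbad : PrimrecRel fun (N : ℕ) (z : List ℕ × ℕ × ℕ × ℕ) =>
      CellBad n (fun i => z.1.getD i 0) z.2.1 (nnratIndex z.2.2.1) z.2.2.2 N :=
    (primrecPred_cellBad n).comp (f := fun w : ℕ × List ℕ × ℕ × ℕ × ℕ =>
      (w.2.1, w.2.2.1, nnratIndex w.2.2.2.1, w.2.2.2.2, w.1))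
      (Primrec.pair (hl.comp Primrec.snd) (Primrec.pair (hS.comp Primrec.snd)
        (Primrec.pair (primrec_nnratIndex (hq.comp Primrec.snd))
          (Primrec.pair (ht.comp Primrec.snd) Primrec.fst))))
  have hbox := primrecPred_dist_ratPoint_lt n
    ((Primrec.list_getD 0).comp hl (Primrec.nat_mul.comp (.const 2) ht)) (.const 0)
    (primrec_addIndex (primrec_addIndex (primrec_dyadicIndex hS (.const 0) (.const 0))
      (primrec_negIndex hq)) (primrec_dyadicIndex (.const 0) (.const 1) ht))
  refine ((Primrec.eq.comp (primrec_unpair_fst hq) (.const 0)).or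
    ((hbad.forall_mem_list.comp (Primrec.list_range.comp hpow) .id).and hbox)).of_eq fun z => ?_
  have e : (ratEnum (addIndex (addIndex (dyadicIndex z.2.1 0 0) (negIndex z.2.2.1))
      (dyadicIndex 0 1 z.2.2.2)) : ℝ) = z.2.1 - nnratEnum z.2.2.1 - 2⁻¹ ^ z.2.2.2 := by
    rw [ratEnum_addIndex, ratEnum_addIndex, ratEnum_negIndex, ratEnum_dyadicIndex,
      ratEnum_dyadicIndex, inv_pow]
    push_cast
    ring
  simp only [FarCert, e, id, List.mem_range]

theorem primrecPred_treeBad (n u : ℕ) :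
    PrimrecPred fun z : List ℕ × ℕ × ℕ => TreeBad n u (fun i => z.1.getD i 0) z.2.1 z.2.2 := by
  have hl : Primrec fun z : List ℕ × ℕ × ℕ => z.1 := Primrec.fst
  have h2 : Primrec fun z : List ℕ × ℕ × ℕ => z.2 := Primrec.snd
  have hk := Primrec.fst.comp h2
  have hN := Primrec.snd.comp h2
  have hm : Primrec fun z : List ℕ × ℕ × ℕ => z.2.2 / (2 ^ (n + 1)) ^ z.2.1 :=
    Primrec.nat_div.comp hN ((Primrec₂.unpaired'.1 Nat.Primrec.pow).comp (.const _) hk)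
  have hS := primrec_unpair_fst hm
  have hq := primrec_unpair_fst (primrec_unpair_snd hm)
  have ht := primrec_unpair_snd (primrec_unpair_snd hm)
  exact ((primrecPred_farCert n).comp (hl.pair (hS.pair (hq.pair ht)))).not.or
    ((primrecPred_cellBad n).comp (hl.pair (hS.pair
      ((primrec_mulIndex (.const u) (primrec_nnratIndex hq)).pair (hk.pair hN)))))

theorem primrec_intervalIndex {c d : α → ℕ} (hf : Primrec f) (hg : Primrec g) (hc : Primrec c)
    (hd : Primrec d) : Primrec fun z => intervalIndex (f z) (g z) (c z) (d z) :=
  Primrec₂.natPair.comp (Primrec₂.natPair.comp (Primrec₂.natPair.comp hf hg) hd)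
    (Primrec₂.natPair.comp hc hd)

theorem primrec_digitBall (B : ℕ) {P : α → ℕ → ℕ → Prop}
    (hP : PrimrecPred fun z => P z (g z) (h z)) (hf : Primrec f) (hg : Primrec g)
    (hh : Primrec h) : Primrec fun z => digitBall B (P z) (f z) (g z) (h z) := by
  classical
  have hden := Primrec.nat_sub.comp (Primrec.nat_mul.comp (.const 4)
    ((Primrec₂.unpaired'.1 Nat.Primrec.pow).comp (.const B) hg)) (.const 1)
  have h4 := Primrec.nat_mul.comp (.const 4) hh
  have hs := Primrec.succ.comp hh
  refine (Primrec.ite (Primrec.eq.comp hf (.const 0))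
    (primrec_intervalIndex (Primrec.nat_add.comp h4 (.const 3)) (.const 0) (.const 1) hden)
    (Primrec.ite (Primrec.eq.comp hf (.const 1)) (Primrec.ite hP
      (primrec_intervalIndex (Primrec.nat_add.comp h4 (.const 1)) (.const 0) (.const 2) hden)
      (.const 0)) (primrec_intervalIndex (.const 0) hs hs (.const 0)))).of_eq fun z => ?_
  simp only [digitBall]

theorem primrec_floorIndex (B : ℕ) (hf : Primrec f) (hg : Primrec g) :
    Primrec fun z => floorIndex B (f z) (g z) := by
  have h4 := Primrec.nat_mul.comp (.const 4)
    ((Primrec₂.unpaired'.1 Nat.Primrec.pow).comp (.const B) hf)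
  have hw := Primrec.succ.comp (primrec_unpair_snd hg)
  exact Primrec.nat_div.comp (Primrec.nat_sub.comp (Primrec.nat_add.comp
    (Primrec.nat_mul.comp h4 (primrec_unpair_fst (primrec_unpair_fst hg))) hw)
    (Primrec.nat_mul.comp h4 (primrec_unpair_snd (primrec_unpair_fst hg))))
    (Primrec.nat_mul.comp (.const 4) hw)

end Primrec

/-! ### The reductions -/

theorem CellBad.congr {n : ℕ} {f g : ℕ → ℕ} {k : ℕ} (h : ∀ i ≤ 2 * k, f i = g i) (S r N : ℕ) :
    CellBad n f S r k N ↔ CellBad n g S r k N := by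
  refine or_congr (exists_congr fun i => and_congr_right fun hi => ?_) ?_
  · rw [h (2 * i + 1) (by omega)]
  · rw [h (2 * k) le_rfl]

theorem FarCert.congr {n : ℕ} {f g : ℕ → ℕ} {t : ℕ} (h : ∀ i ≤ 2 * t, f i = g i) (S q : ℕ) :
    FarCert n f S q t ↔ FarCert n g S q t := by
  refine or_congr Iff.rfl (and_congr (forall₂_congr fun N _ => CellBad.congr h _ _ _) ?_)
  rw [h (2 * t) le_rfl]

/-- The stage `t` of the certificate is decoded from `N`, so `t ≤ N` and a prefix of the name of
length governed by `k` and `N` decides the test. -/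
theorem TreeBad.congr {n u : ℕ} {f g : ℕ → ℕ} {k N : ℕ} (hk : ∀ i ≤ 2 * k, f i = g i)
    (hN : ∀ i ≤ 2 * N, f i = g i) : TreeBad n u f k N ↔ TreeBad n u g k N := by
  refine or_congr (not_congr (FarCert.congr (fun i hi => hN i (hi.trans ?_)) _ _))
    (CellBad.congr hk _ _ _)
  exact Nat.mul_le_mul_left 2 ((Nat.unpair_right_le _).trans
    ((Nat.unpair_right_le _).trans (Nat.div_le_self _ _)))

theorem primrec_digitBall_treeBad (n u : ℕ) : Primrec₂ fun (e : ℕ) (l : List ℕ) =>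
    digitBall (2 ^ (n + 1)) (TreeBad n u fun i => l.getD i 0) e.unpair.1
      e.unpair.2.unpair.1 e.unpair.2.unpair.2 := by
  have he : Primrec fun z : ℕ × List ℕ => z.1 := Primrec.fst
  have hk := primrec_unpair_fst (primrec_unpair_snd he)
  have hN := primrec_unpair_snd (primrec_unpair_snd he)
  have hP : PrimrecPred fun z : ℕ × List ℕ =>
      TreeBad n u (fun i => z.2.getD i 0) z.1.unpair.2.unpair.1 z.1.unpair.2.unpair.2 :=
    (primrecPred_treeBad n u).comp (f := fun z : ℕ × List ℕ =>
      (z.2, z.1.unpair.2.unpair.1, z.1.unpair.2.unpair.2)) (Primrec.snd.pair (hk.pair hN))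
  exact primrec_digitBall (2 ^ (n + 1))
      (P := fun (z : ℕ × List ℕ) => TreeBad n u fun i => z.2.getD i 0) hP
      (primrec_unpair_fst he) hk hN

theorem digitSetName_treeBad_eq (n u : ℕ) (p : Baire) (e : ℕ) :
    digitSetName (2 ^ (n + 1)) (TreeBad n u p) e =
      digitBall (2 ^ (n + 1)) (TreeBad n u fun i => (initSeg p (2 * e + 1)).getD i 0) e.unpair.1
        e.unpair.2.unpair.1 e.unpair.2.unpair.2 := by
  classical
  have h : TreeBad n u p e.unpair.2.unpair.1 e.unpair.2.unpair.2 ↔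
      TreeBad n u (fun i => (initSeg p (2 * e + 1)).getD i 0)
        e.unpair.2.unpair.1 e.unpair.2.unpair.2 := by
    have h1 : e.unpair.2.unpair.1 ≤ e := (Nat.unpair_left_le _).trans (Nat.unpair_right_le _)
    have h2 : e.unpair.2.unpair.2 ≤ e := (Nat.unpair_right_le _).trans (Nat.unpair_right_le _)
    exact TreeBad.congr (fun i hi => (getD_initSeg (by omega)).symm)
      fun i hi => (getD_initSeg (by omega)).symm
  rw [digitSetName, digitBall, digitBall]
  exact if_congr Iff.rfl rfl (if_congr Iff.rfl (if_congr h rfl rfl) rfl)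

theorem isComputable_digitSetName_treeBad (n u : ℕ) :
    IsComputable fun p => Part.some (digitSetName (2 ^ (n + 1)) (TreeBad n u p)) :=
  isComputable_of_primrec (primrec_digitBall_treeBad n u)
    (h := fun e _ => 2 * e + 1) (Primrec.succ.comp (Primrec.nat_mul.comp (.const 2) Primrec.fst)) 0
    fun p e => digitSetName_treeBad_eq n u p e

/-- The name of a point of `ℝ ^ n` which is read off from a name of a point of `digitSet`. -/
def cellName (n : ℕ) (p : Baire) (i : ℕ) : ℕ :=
  cellCorner n (floorIndex (2 ^ (n + 1)) 0 (p 3)).unpair.1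
    (i + 1 + 2 * n * (floorIndex (2 ^ (n + 1)) 0 (p 3)).unpair.1)
    (floorIndex (2 ^ (n + 1)) (i + 1 + 2 * n * (floorIndex (2 ^ (n + 1)) 0 (p 3)).unpair.1)
      (p ((n + 1) * (i + 1 + 2 * n * (floorIndex (2 ^ (n + 1)) 0 (p 3)).unpair.1) + 3)))

theorem isComputable_cellName (n : ℕ) : IsComputable fun p => Part.some (cellName n p) := by
  have hS {α : Type} [Primcodable α] {f : α → ℕ} (hf : Primrec f) :
      Primrec fun z => (floorIndex (2 ^ (n + 1)) 0 (f z)).unpair.1 :=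
    primrec_unpair_fst (primrec_floorIndex _ (.const 0) hf)
  have hlev {α : Type} [Primcodable α] {f g : α → ℕ} (hf : Primrec f) (hg : Primrec g) :
      Primrec fun z => f z + 1 + 2 * n * (floorIndex (2 ^ (n + 1)) 0 (g z)).unpair.1 :=
    Primrec.nat_add.comp (Primrec.succ.comp hf) (Primrec.nat_mul.comp (.const (2 * n)) (hS hg))
  have hpos {α : Type} [Primcodable α] {f g : α → ℕ} (hf : Primrec f) (hg : Primrec g) :
      Primrec fun z =>
        (n + 1) * (f z + 1 + 2 * n * (floorIndex (2 ^ (n + 1)) 0 (g z)).unpair.1) + 3 :=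
    Primrec.nat_add.comp (Primrec.nat_mul.comp (.const (n + 1)) (hlev hf hg)) (.const 3)
  have h3 : Primrec fun z : ℕ × List ℕ => z.2.getD 3 0 :=
    (Primrec.list_getD 0).comp Primrec.snd (.const 3)
  have hg : Primrec₂ fun (e : ℕ) (l : List ℕ) => cellName n (fun i => l.getD i 0) e :=
    primrec_cellCorner n (hS h3) (hlev Primrec.fst h3) (primrec_floorIndex _ (hlev Primrec.fst h3)
      ((Primrec.list_getD 0).comp Primrec.snd (hpos Primrec.fst h3)))
  -- The depth of the cell to be read depends on `S`, which the single term `p 3` determines; this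
  -- is the fixed term on which the length of the prefix depends.
  have hh : Primrec₂ fun (e c : ℕ) =>
      (n + 1) * (e + 1 + 2 * n * (floorIndex (2 ^ (n + 1)) 0 c).unpair.1) + 3 + 1 :=
    Primrec.succ.comp (hpos Primrec.fst Primrec.snd)
  refine isComputable_of_primrec hg hh 3 fun p e => ?_
  have e3 : (initSeg p ((n + 1) * (e + 1 + 2 * n *
      (floorIndex (2 ^ (n + 1)) 0 (p 3)).unpair.1) + 3 + 1)).getD 3 0 = p 3 :=
    getD_initSeg (by omega)
  simp only [cellName, e3]
  rw [getD_initSeg (Nat.lt_succ_self _)]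

theorem cauchyRep_names_cellName {n : ℕ} {P : ℕ → ℕ → Prop} {z : ℝ}
    (hz : z ∈ digitSet (2 ^ (n + 1)) P) {y : EuclideanSpace ℝ (Fin n)}
    (hy : ∀ k, InCell n ⌊z⌋₊.unpair.1 k ⌊((2 ^ (n + 1) : ℕ) : ℝ) ^ k * z⌋₊ y) {q : Baire}
    (hq : (cauchyRep ℝ).Names q z) :
    (cauchyRep (EuclideanSpace ℝ (Fin n))).Names (cellName n q) y := by
  -- The term at place `(n + 1) * k + 3` has error at most `1 / (8 * B ^ k)` for `B = 2 ^ (n + 1)`,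
  -- as `floorIndex_eq` requires.
  have hfl : ∀ k, floorIndex (2 ^ (n + 1)) k (q ((n + 1) * k + 3)) =
      ⌊((2 ^ (n + 1) : ℕ) : ℝ) ^ k * z⌋₊ := fun k => by
    refine floorIndex_eq hz ?_
    have h : |(ratEnum (q ((n + 1) * k + 3)) : ℝ) - z| ≤ 2⁻¹ ^ ((n + 1) * k + 3) := by
      rw [← Real.dist_eq]
      exact dist_pt_le_of_names hq _
    refine (mul_le_mul_of_nonneg_right h (by positivity)).trans (le_of_eq ?_)
    push_cast
    rw [← pow_mul, pow_add, mul_right_comm, ← mul_pow]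
    norm_num
  have h0 : floorIndex (2 ^ (n + 1)) 0 (q 3) = ⌊z⌋₊ := by
    have := hfl 0
    rwa [mul_zero, zero_add, pow_zero, one_mul] at this
  have h1 : cellName n q = fun i => cellCorner n ⌊z⌋₊.unpair.1 (i + 1 + 2 * n * ⌊z⌋₊.unpair.1)
      ⌊((2 ^ (n + 1) : ℕ) : ℝ) ^ (i + 1 + 2 * n * ⌊z⌋₊.unpair.1) * z⌋₊ := by
    funext i
    rw [cellName, h0, hfl]
  rw [h1]
  exact cauchyRep_names_cellCorner (N := fun k => ⌊((2 ^ (n + 1) : ℕ) : ℝ) ^ k * z⌋₊) hy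

theorem approxNegProj_strongReducible_closedChoice {ε : ℝ} (hε : 0 < ε) (n : ℕ) :
    StrongReducible (approxNegProj (EuclideanSpace ℝ (Fin n)) ε) (closedChoice ℝ) := by
  -- The real number `ε` need not be computable; the machines use only a rational factor below `1 +
  -- ε`.
  obtain ⟨a, ha1, ha2⟩ := exists_rat_btwn (show (1 : ℝ) < 1 + ε by linarith)
  obtain ⟨u, rfl⟩ := ratEnum_surjective a
  have hu : 1 < ratEnum u := by exact_mod_cast ha1
  refine strongReducible_of_total (isComputable_cellName n)
    (isComputable_digitSetName_treeBad n u) ?_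
  rintro p ⟨x, A⟩ ⟨hx, hA⟩ ⟨y₀, hy₀, -⟩
  have hx' : ∀ i, dist (ratPoint n (p (2 * i))) x ≤ 2⁻¹ ^ i := dist_pt_le_of_names hx
  have hA' : (A : Set (EuclideanSpace ℝ (Fin n))) = (⋃ i, basicBall (p (2 * i + 1)))ᶜ := hA
  have hne : (A : Set (EuclideanSpace ℝ (Fin n))).Nonempty := ⟨y₀, hy₀⟩
  have heq := digitSet_eq (show 0 < 2 ^ (n + 1) by positivity) (TreeBad n u p)
  have hcl : IsClosed (digitSet (2 ^ (n + 1)) (TreeBad n u p)) := by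
    rw [heq]
    exact (isOpen_iUnion fun i => Metric.isOpen_ball).isClosed_compl
  refine ⟨⟨_, hcl⟩, heq, digitSet_treeBad_nonempty hx' hA' hne hu, fun z hz q hq => ?_⟩
  obtain ⟨y, hyA, hyd, hy⟩ :=
    exists_approxProj_of_mem_digitSet hx' hA' hne (zero_le_one.trans hu.le) ha2.le hz
  exact ⟨y, ⟨hyA, hyd⟩, cauchyRep_names_cellName hz hy hq⟩

/-! ### Closed choice on the line from approximate projection: slabs over closed sets of reals -/

/-- The ball with index `b` in `ℝ ^ n` is recognized to lie over the ball with index `c` in `ℝ`,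
the former being projected to the first coordinate. -/
def SlabContains (c b : ℕ) : Prop :=
  dist (ratPoint 1 (encode [(ofNat (List ℕ) b.unpair.1).getD 0 0]))
    (ratPoint 1 (encode [c.unpair.1])) < nnratEnum c.unpair.2 - nnratEnum b.unpair.2

theorem dist_ratPoint_one (a b : ℕ) :
    dist (ratPoint 1 (encode [a])) (ratPoint 1 (encode [b])) = |(ratEnum a : ℝ) - ratEnum b| := by
  rw [EuclideanSpace.dist_eq, Fin.sum_univ_one, Real.sqrt_sq dist_nonneg, Real.dist_eq]
  simp [ratPoint]

theorem primrecPred_slabContains {α : Type*} [Primcodable α] {f g : α → ℕ} (hf : Primrec f)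
    (hg : Primrec g) : PrimrecPred fun z => SlabContains (f z) (g z) := by
  have hsing {h : α → ℕ} (hh : Primrec h) : Primrec fun z => encode [h z] :=
    Primrec.encode.comp (Primrec.list_cons.comp hh (.const []))
  refine (primrecPred_dist_ratPoint_lt 1 (hsing ((Primrec.list_getD 0).comp
    ((Primrec.ofNat (List ℕ)).comp (primrec_unpair_fst hg)) (.const 0)))
    (hsing (primrec_unpair_fst hf)) (primrec_addIndex
      (primrec_nnratIndex (primrec_unpair_snd hf))
      (primrec_negIndex (primrec_unpair_snd hg)))).of_eq fun z => ?_
  rw [SlabContains, ratEnum_addIndex, ratEnum_nnratIndex, ratEnum_negIndex, ← sub_eq_add_neg]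
  push_cast
  rfl

/-- The preimage of an interval under the first coordinate is open, hence a union of rational balls.
The test in `SlabContains` is sound because the coordinate map does not increase distances, and a
small ball centred near `y` always passes it. -/
theorem mem_basicBall_coord_iff {n : ℕ} (j : Fin n) (hj : (j : ℕ) = 0) (c : ℕ)
    (y : EuclideanSpace ℝ (Fin n)) :
    y j ∈ (basicBall c : Set ℝ) ↔
      ∃ b, SlabContains c b ∧ y ∈ (basicBall b : Set (EuclideanSpace ℝ (Fin n))) := by
  have hcoord : ∀ (k : ℕ) (z : EuclideanSpace ℝ (Fin n)),
      |(ratEnum ((ofNat (List ℕ) k).getD 0 0) : ℝ) - z j| ≤ dist (ratPoint n k) z := fun k z => by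
    have h := PiLp.norm_apply_le (ratPoint n k - z) j
    rw [← dist_eq_norm] at h
    simpa [ratPoint, hj] using h
  have hc : y j ∈ (basicBall c : Set ℝ) ↔
      |y j - ratEnum c.unpair.1| < nnratEnum c.unpair.2 := Iff.rfl
  have hb : ∀ b, y ∈ (basicBall b : Set (EuclideanSpace ℝ (Fin n))) ↔
      dist (ratPoint n b.unpair.1) y < nnratEnum b.unpair.2 := fun b => Metric.mem_ball'
  rw [hc]
  simp only [hb, SlabContains, dist_ratPoint_one]
  constructor
  · intro h
    obtain ⟨s, hs0, hs⟩ := exists_rat_btwn (half_pos (sub_pos.2 h))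
    obtain ⟨m, rfl⟩ := exists_nnratEnum_eq (q := s) (by exact_mod_cast hs0.le)
    obtain ⟨k, hk⟩ := (ratPoint_dense n).exists_dist_lt y hs0
    refine ⟨Nat.pair k m, ?_, ?_⟩
    · rw [Nat.unpair_pair]
      have h1 := hcoord k y
      have h2 := abs_sub_le (ratEnum ((ofNat (List ℕ) k).getD 0 0) : ℝ) (y j) (ratEnum c.unpair.1)
      rw [dist_comm] at hk
      dsimp only
      linarith
    · rw [Nat.unpair_pair, dist_comm]
      exact hk
  · rintro ⟨b, h1, h2⟩
    have h3 := hcoord b.unpair.1 y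
    have h4 := abs_sub_le (y j) (ratEnum ((ofNat (List ℕ) b.unpair.1).getD 0 0) : ℝ)
      (ratEnum c.unpair.1)
    rw [abs_sub_comm (y j) (ratEnum ((ofNat (List ℕ) b.unpair.1).getD 0 0) : ℝ)] at h4
    linarith

open Classical in
/-- For a name `p` of a closed set of real numbers, a joint name of the origin of `ℝ ^ n` and of
the set of those points of `ℝ ^ n` whose first coordinate lies in the given set. -/
noncomputable def slabName (p : Baire) (e : ℕ) : ℕ :=
  if e % 2 = 0 then 0
  else if SlabContains (p (e / 2).unpair.1) (e / 2).unpair.2 then (e / 2).unpair.2 else 0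

theorem isComputable_slabName : IsComputable fun p => Part.some (slabName p) := by
  classical
  have hd : Primrec fun z : ℕ × List ℕ => z.1 / 2 :=
    Primrec.nat_div.comp Primrec.fst (.const 2)
  have hb := primrec_unpair_snd hd
  have hg : Primrec₂ fun (e : ℕ) (l : List ℕ) => slabName (fun i => l.getD i 0) e := by
    refine (Primrec.ite (Primrec.eq.comp (Primrec.nat_mod.comp Primrec.fst (.const 2)) (.const 0))
      (.const 0) (Primrec.ite (primrecPred_slabContains
        ((Primrec.list_getD 0).comp Primrec.snd (primrec_unpair_fst hd)) hb) hb
        (.const 0))).of_eq fun z => ?_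
    simp only [slabName]
  have hh : Primrec₂ fun e (_ : ℕ) => e + 1 := Primrec.succ.comp Primrec.fst
  refine isComputable_of_primrec hg hh 0 fun p e => ?_
  have h := (Nat.unpair_left_le (e / 2)).trans (Nat.div_le_self e 2)
  simp only [slabName, getD_initSeg (Nat.lt_succ_of_le h)]

/-- The name of the first coordinate of the point named by `q`. -/
def firstCoordName (q : Baire) (i : ℕ) : ℕ := (ofNat (List ℕ) (q i)).getD 0 0

theorem isComputable_firstCoordName : IsComputable fun q => Part.some (firstCoordName q) := by
  have hg : Primrec₂ fun (e : ℕ) (l : List ℕ) => firstCoordName (fun i => l.getD i 0) e :=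
    (Primrec.list_getD 0).comp ((Primrec.ofNat (List ℕ)).comp
      ((Primrec.list_getD 0).comp Primrec.snd Primrec.fst)) (.const 0)
  have hh : Primrec₂ fun e (_ : ℕ) => e + 1 := Primrec.succ.comp Primrec.fst
  refine isComputable_of_primrec hg hh 0 fun p e => ?_
  simp only [firstCoordName, getD_initSeg (Nat.lt_succ_self e)]

theorem closedChoice_strongReducible_approxNegProj {ε : ℝ} (hε : 0 < ε) {n : ℕ} (hn : 1 ≤ n) :
    StrongReducible (closedChoice ℝ) (approxNegProj (EuclideanSpace ℝ (Fin n)) ε) := by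
  classical
  let j : Fin n := ⟨0, hn⟩
  have hcont : Continuous fun y : EuclideanSpace ℝ (Fin n) => y j := by fun_prop
  refine strongReducible_of_total isComputable_firstCoordName isComputable_slabName ?_
  rintro p (A : TopologicalSpace.Closeds ℝ) hA ⟨a, ha⟩
  let C : TopologicalSpace.Closeds (EuclideanSpace ℝ (Fin n)) :=
    ⟨(fun y => y j) ⁻¹' (A : Set ℝ), A.isClosed.preimage hcont⟩
  have hA' : (A : Set ℝ) = (⋃ i, basicBall (p i))ᶜ := hA
  have hC : (C : Set (EuclideanSpace ℝ (Fin n))).Nonempty :=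
    ⟨WithLp.toLp 2 fun _ => a, ha⟩
  refine ⟨(ratPoint n 0, C), ⟨?_, ?_⟩, ?_, ?_⟩
  · have h0 : (fun i => slabName p (2 * i)) = fun _ => 0 := by
      funext i
      simp [slabName]
    change (cauchyRep _).Names (fun i => slabName p (2 * i)) _
    rw [h0]
    refine ⟨fun i k _ => ?_, tendsto_const_nhds⟩
    rw [dist_self]
    positivity
  · change (C : Set (EuclideanSpace ℝ (Fin n))) = (⋃ i, basicBall (slabName p (2 * i + 1)))ᶜ
    ext y
    have h1 : y ∈ (C : Set (EuclideanSpace ℝ (Fin n))) ↔ y j ∈ (A : Set ℝ) := Iff.rfl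
    rw [h1, hA', Set.mem_compl_iff, Set.mem_compl_iff, not_iff_not, Set.mem_iUnion,
      Set.mem_iUnion]
    have hs : ∀ i, slabName p (2 * i + 1) =
        if SlabContains (p i.unpair.1) i.unpair.2 then i.unpair.2 else 0 := fun i => by
      have h2 : (2 * i + 1) / 2 = i := by omega
      rw [slabName, if_neg (by omega), h2]
    have hemp : y ∉ (basicBall 0 : Set (EuclideanSpace ℝ (Fin n))) := by
      simp [basicBall, nnratEnum]
    constructor
    · rintro ⟨i, hi⟩
      obtain ⟨b, hb, hy⟩ := (mem_basicBall_coord_iff j rfl (p i) y).1 hi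
      refine ⟨Nat.pair i b, ?_⟩
      rw [hs, Nat.unpair_pair, if_pos hb]
      exact hy
    · rintro ⟨i, hi⟩
      rw [hs] at hi
      split_ifs at hi with h
      · exact ⟨_, (mem_basicBall_coord_iff j rfl _ y).2 ⟨_, h, hi⟩⟩
      · exact absurd hi hemp
  -- An exact nearest point exists and is in particular an approximate one, so the instance is in
  -- the domain.
  · obtain ⟨y, hyC, hy⟩ := C.isClosed.exists_infDist_eq_dist hC (ratPoint n 0)
    refine ⟨y, hyC, ?_⟩
    change dist (ratPoint n 0) y ≤ (1 + ε) * Metric.infDist (ratPoint n 0) (C : Set _)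
    rw [hy]
    exact le_mul_of_one_le_left dist_nonneg (by linarith)
  · rintro (y : EuclideanSpace ℝ (Fin n)) ⟨hy, -⟩ q ⟨hq1, hq2⟩
    have hcoord : ∀ i, (ratEnum (firstCoordName q i) : ℝ) = ratPoint n (q i) j := fun i => rfl
    refine ⟨y j, hy, fun i k hik => ?_, ?_⟩
    · refine le_trans ?_ (hq1 i k hik)
      change dist (ratEnum (firstCoordName q i) : ℝ) (ratEnum (firstCoordName q k)) ≤
        dist (ratPoint n (q i)) (ratPoint n (q k))
      rw [hcoord, hcoord, dist_eq_norm, dist_eq_norm]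
      exact PiLp.norm_apply_le (ratPoint n (q i) - ratPoint n (q k)) j
    · exact (hcont.tendsto y).comp hq2

end Weih

theorem mainTheorem7 (ε : ℝ) (hε : 0 < ε) (n : ℕ) (hn : 1 ≤ n) :
    Weih.StrongEquiv (Weih.approxNegProj (EuclideanSpace ℝ (Fin n)) ε)
      (Weih.closedChoice ℝ) :=
  ⟨Weih.approxNegProj_strongReducible_closedChoice hε n,
    Weih.closedChoice_strongReducible_approxNegProj hε hn⟩
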